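/- Let $G$ be a group and let $S\subseteq G$ be a finite symmetric generating set ($S=S^{-1}$). Write $S^*$ for the set of words in the letters $S$ and $\bar w\in G$ for the element represented by $w\in S^*$. The spectral radius of $(G,S)$ is $$\rho(G,S)=\limsup_{n\to\infty}p(n)^{1/n},\qquad p(n)=\frac{\#\{w\in S^n : \bar w=e_G\}}{|S|^n}.$$ A real number $x$ is upper semi-computable if there is an algorithm enumerating a (weakly) decreasing sequence $(x_k)$ of real algebraic numbers with $x_k\to x$, where each $x_k$ is specified by a triple $(P_k,a_k,b_k)\in\mathbb Q[X]\times\mathbb Q\times\mathbb Q$ with $P_k\neq 0$ such that $x_k$ is the only root of $P_k$ in the interval $[a_k,b_k]$. **Theorem.** Suppose that $(G,S)$ is recursively presented, i.e. $G=\langle S\mid R\rangle$ for some recursively enumerable set $R$ of words in the letters $S$ and their formal inverses, and that $\rho(G,S)$ is upper semi-computable. Let $W\subseteq S^*$ be a set of words such that, for each $w\in W$, either $\bar w=e_G$ or the normal closure $\langle\!\langle\bar w\rangle\!\rangle_G$ of $\bar w$ in $G$ is non-amenable (as a discrete group). Then there exists an algorithm which, given a word $w\in W$, decides whether $\bar w=e_G$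 or not (nothing is required of the algorithm on words outside $W$). In particular, if this hypothesis holds for $W=S^*$, then $G$ has decidable word problem, i.e. $\{w\in S^*:\bar w=e_G\}$ is a recursive set. -/

import Mathlib

namespace MarkedGroup

/-- A discrete group is amenable if it carries a finitely additive, left-invariant probability
measure defined on all its subsets. -/
def IsAmenable (H : Type*) [Group H] : Prop :=
  ∃ m : Set H → ℝ,
    (∀ A, 0 ≤ m A) ∧ m Set.univ = 1 ∧
    (∀ A B, Disjoint A B → m (A ∪ B) = m A + m B) ∧
    ∀ (h : H) (A : Set H), m ((fun x => h * x) '' A) = m A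

/-- The letters of a finite alphabet are coded by numbering them. Any two numberings of a finite
set differ by a computable bijection, so the chosen one does not matter. -/
noncomputable instance instPrimcodableLetters {G : Type*} (S : Finset G) : Primcodable S :=
  Primcodable.ofEquiv (Fin S.card) S.equivFin

/-- The element of the group represented by a word in the letters `S`. -/
def eval {G : Type*} [Group G] {S : Finset G} (w : List S) : G :=
  (w.map Subtype.val).prod

/-- The probability that the simple random walk on the Cayley graph of `(G, S)` started at the
identity is back at the identity after `n` steps: the proportion of words of length `n` in the
letters `S` that represent the identity. -/
noncomputable def returnProb {G : Type*} [Group G] (S : Finset G) (n : ℕ) : ℝ :=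
  (Nat.card {w : List S // w.length = n ∧ eval w = 1} : ℝ) / (S.card : ℝ) ^ n

/-- The spectral radius `limsup p(n)^(1/n)`. -/
noncomputable def spectralRadius {G : Type*} [Group G] (S : Finset G) : ℝ :=
  Filter.limsup (fun n : ℕ => returnProb S n ^ (1 / (n : ℝ))) Filter.atTop

/-- `(G, S)` is recursively presented: the relations between the generators `S` of `G` are exactly
the consequences of some recursively enumerable set `R` of words in the letters `S` and their
formal inverses, that is, `G = ⟨S ∣ R⟩`
(provided that `S` generates `G`). -/
def IsRecursivelyPresented {G : Type*} [Group G] (S : Finset G) : Prop :=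
  ∃ R : List (S × Bool) → Prop, REPred R ∧
    (FreeGroup.lift (Subtype.val : S → G)).ker =
      Subgroup.normalClosure {x : FreeGroup S | ∃ r, R r ∧ FreeGroup.mk r = x}

/-- A pair `(p, q)` codes the rational number `p / (q + 1)`. -/
abbrev RatCode : Type := ℤ × ℕ

/-- The rational number with a given code. -/
def RatCode.toRat (c : RatCode) : ℚ := (c.1 : ℚ) / ((c.2 : ℚ) + 1)

/-- The polynomial with a given list of (codes of) coefficients, constant term first. -/
noncomputable def polyOfList : List RatCode → Polynomial ℚ
  | [] => 0
  | c :: l => Polynomial.C c.toRat + Polynomial.X * polyOfList l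

/-- Triples (polynomial, left endpoint, right endpoint) specifying real algebraic numbers. -/
abbrev AlgCode : Type := List RatCode × RatCode × RatCode

/-- `c = (P, a, b)` specifies the real algebraic number `x`: `P ≠ 0` and `x` is the only root of `P`
in the interval `[a, b]`. -/
def AlgCode.Specifies (c : AlgCode) (x : ℝ) : Prop :=
  polyOfList c.1 ≠ 0 ∧
    {y : ℝ | y ∈ Set.Icc (c.2.1.toRat : ℝ) (c.2.2.toRat : ℝ) ∧
      Polynomial.aeval y (polyOfList c.1) = 0} = {x}

/-- `x` is upper semi-computable: some algorithm enumerates a decreasing sequence of real algebraic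
numbers converging to `x`. -/
def IsUpperSemicomputable (x : ℝ) : Prop :=
  ∃ (c : ℕ → AlgCode) (y : ℕ → ℝ), Computable c ∧ (∀ k, (c k).Specifies (y k)) ∧
    Antitone y ∧ Filter.Tendsto y Filter.atTop (nhds x)

/-- Some algorithm, given a word `w ∈ W`, stops and decides whether `w` represents the identity.
Nothing is required of it, not even termination, on words outside `W`. -/
def WordProblemDecidableOn {G : Type*} [Group G] {S : Finset G} (W : Set (List S)) : Prop :=
  ∃ f : List S →. Bool, Partrec f ∧
    ∀ w ∈ W, ∃ b : Bool, b ∈ f w ∧ (b = true ↔ eval w = 1)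

/-- `(G, S)` has decidable word problem. -/
def HasDecidableWordProblem {G : Type*} [Group G] (S : Finset G) : Prop :=
  ComputablePred fun w : List S => eval w = 1

end MarkedGroup

/-! A recursive presentation makes triviality semi-decidable: enumerate all consequences of the
relators. The work lies in a semi-decision procedure for nontriviality that is always sound, and
complete when `N`, the normal closure of `eval w`, is non-amenable.

Let `ρ` be the spectral radius. For every `n`, at most `(ρ|S|)^(2n)` words of length `2n` represent
the identity (`wordCount_le_spectralRadius_pow`). Hence a rational `q > ρ` together with more than
`(q|S|)^(2n)` distinct words of length `2n` in `N` proves that `N` is not trivial. Such certificates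
can be enumerated: membership in `N` is semi-decidable uniformly in `w`, since `G ⧸ N` is presented
by adding `w` to the relators, and `q > ρ` is semi-decidable because `ρ` is upper semi-computable.

Certificates exist by Kesten's criterion `isAmenable_of_wordCount_le`: if the even word counts of
`N` never exceed `Λ ^ n` with `Λ = (ρ|S|)^2`, then `N` is amenable. Let `A` be the sum of the
translations by `S`. The counts bound `‖A^m F‖² ≤ Λ^m ‖F‖²` on `G ⧸ N`, while `f_n = A^n δ`
satisfies `‖A^m f_n‖² / ‖f_n‖² → Λ^m` on `G`. Sending `f` to its norms on the cosets of `N`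
preserves the norm and does not decrease inner products. Near equality between `G` and `G ⧸ N` then
forces `f_n` to be almost invariant under elements of `N` given by words of even length, and an
ultralimit of the densities `f_n²` yields an invariant mean. Self-adjointness and Cauchy–Schwarz on
finitely supported functions replace spectral theory throughout. -/

namespace REPred

/-! ### Closure properties of recursively enumerable predicates. -/

open Encodable Nat.Partrec

variable {α β : Type*} [Primcodable α] [Primcodable β]

/-- A recursively enumerable predicate is the increasing union of primitive recursive ones. -/
theorem exists_primrec {p : α → Prop} (hp : REPred p) :
    ∃ q : α → ℕ → Bool, Primrec₂ q ∧ (∀ a m n, m ≤ n → q a m = true → q a n = true) ∧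
      ∀ a, p a ↔ ∃ n, q a n = true := by
  obtain ⟨c, hc⟩ := Code.exists_code.1 (Partrec.bind_decode₂_iff.1 hp)
  -- `q a k` tests whether a program semi-deciding `p` halts on `a` within the bound `k`.
  -- Monotonicity in `k` later lets finitely many searches share one bound.
  refine ⟨fun a k => (Code.evaln k c (encode a)).isSome, ?_, ?_, ?_⟩
  · exact Primrec.option_isSome.comp (Code.primrec_evaln.comp
      ((Primrec.snd.pair (Primrec.const c)).pair (Primrec.encode.comp Primrec.fst)))
  · intro a m n hmn h
    obtain ⟨x, hx⟩ := Option.isSome_iff_exists.1 h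
    exact Option.isSome_iff_exists.2 ⟨x, Code.evaln_mono hmn hx⟩
  · intro a
    have h1 : p a ↔ (Code.eval c (encode a)).Dom := by
      rw [hc]
      simp [Part.assert, Part.dom_iff_mem]
    rw [h1, Part.dom_iff_mem]
    constructor
    · rintro ⟨x, hx⟩
      obtain ⟨k, hk⟩ := Code.evaln_complete.1 hx
      exact ⟨k, Option.isSome_iff_exists.2 ⟨x, hk⟩⟩
    · rintro ⟨k, hk⟩
      obtain ⟨x, hx⟩ := Option.isSome_iff_exists.1 hk
      exact ⟨x, Code.evaln_sound hx⟩

theorem of_exists_nat {p : α → Prop} {q : α → ℕ → Bool} (hq : Primrec₂ q)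
    (h : ∀ a, p a ↔ ∃ n, q a n = true) : REPred p := by
  have h1 : Partrec fun a => Nat.rfind fun n => Part.some (q a n) :=
    Partrec.rfind hq.to_comp.partrec₂
  refine h1.dom_re.of_eq fun a => ?_
  rw [h]
  exact Nat.rfind_dom'.trans (by simp)

theorem comp {p : β → Prop} (hp : REPred p) {f : α → β} (hf : Computable f) :
    REPred fun a => p (f a) :=
  Partrec.comp hp hf

theorem exists_snd {p : α × β → Prop} (hp : REPred p) : REPred fun a => ∃ b, p (a, b) := by
  obtain ⟨q, hq, -, h⟩ := hp.exists_primrec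
  refine of_exists_nat
    -- Dovetailing: `n` packs a candidate `b` with a time bound, and numbers coding no candidate are
    -- rejected.
    (q := fun a n => ((decode (α := β) n.unpair.1).map fun b => q (a, b) n.unpair.2).getD false)
    ?_ ?_
  · refine Primrec.option_getD.comp (Primrec.option_map
      (Primrec.decode.comp (Primrec.fst.comp (Primrec.unpair.comp Primrec.snd))) ?_)
      (Primrec.const false)
    exact hq.comp ((Primrec.fst.comp Primrec.fst).pair Primrec.snd)
      (Primrec.snd.comp (Primrec.unpair.comp (Primrec.snd.comp Primrec.fst)))
  · intro a
    simp only [h]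
    constructor
    · rintro ⟨b, n, hn⟩
      exact ⟨Nat.pair (encode b) n, by simpa using hn⟩
    · rintro ⟨n, hn⟩
      cases hb : decode (α := β) n.unpair.1 with
      | none => simp [hb] at hn
      | some b => exact ⟨b, n.unpair.2, by simpa [hb] using hn⟩

theorem and {p q : α → Prop} (hp : REPred p) (hq : REPred q) : REPred fun a => p a ∧ q a := by
  obtain ⟨p', hp', mp, h⟩ := hp.exists_primrec
  obtain ⟨q', hq', mq, h'⟩ := hq.exists_primrec
  refine of_exists_nat (q := fun a n => p' a n && q' a n) (Primrec.and.comp₂ hp' hq') fun a => ?_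
  simp only [h, h', Bool.and_eq_true]
  constructor
  · rintro ⟨⟨m, hm⟩, n, hn⟩
    exact ⟨max m n, mp _ _ _ (le_max_left _ _) hm, mq _ _ _ (le_max_right _ _) hn⟩
  · rintro ⟨n, h1, h2⟩
    exact ⟨⟨n, h1⟩, n, h2⟩

theorem or {p q : α → Prop} (hp : REPred p) (hq : REPred q) : REPred fun a => p a ∨ q a := by
  obtain ⟨p', hp', -, h⟩ := hp.exists_primrec
  obtain ⟨q', hq', -, h'⟩ := hq.exists_primrec
  refine of_exists_nat (q := fun a n => p' a n || q' a n) (Primrec.or.comp₂ hp' hq') fun a => ?_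
  simp only [h, h', Bool.or_eq_true, exists_or]

theorem forall_mem_list {p : α × β → Prop} (hp : REPred p) :
    REPred fun x : α × List β => ∀ b ∈ x.2, p (x.1, b) := by
  obtain ⟨q, hq, mq, h⟩ := hp.exists_primrec
  have hR : PrimrecRel fun (L : List β) (y : α × ℕ) => ∀ b ∈ L, q (y.1, b) y.2 = true := by
    refine PrimrecRel.forall_mem_list (R := fun (b : β) (y : α × ℕ) => q (y.1, b) y.2 = true) ?_
    refine primrecPred_iff_primrec_decide.2 ?_
    simp only [Bool.decide_eq_true]
    exact hq.comp ((Primrec.fst.comp Primrec.snd).pair Primrec.fst)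
      (Primrec.snd.comp Primrec.snd)
  refine of_exists_nat (q := fun x n => decide (∀ b ∈ x.2, q (x.1, b) n = true)) ?_ fun x => ?_
  · exact (primrecRel_iff_primrec_decide.1 hR).comp (Primrec.snd.comp Primrec.fst)
      ((Primrec.fst.comp Primrec.fst).pair Primrec.snd)
  · simp only [h, decide_eq_true_eq]
    constructor
    · intro hx
      obtain ⟨a, l⟩ := x
      simp only at hx ⊢
      induction l with
      | nil => exact ⟨0, by simp⟩
      | cons b l ih =>
        obtain ⟨n, hn⟩ := ih fun b hb => hx b (List.mem_cons_of_mem _ hb)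
        obtain ⟨m, hm⟩ := hx b List.mem_cons_self
        refine ⟨max m n, fun b' hb' => ?_⟩
        rcases List.mem_cons.1 hb' with rfl | hb'
        · exact mq _ _ _ (le_max_left _ _) hm
        · exact mq _ _ _ (le_max_right _ _) (hn b' hb')
    · rintro ⟨n, hn⟩ b hb
      exact ⟨n, hn b hb⟩

end REPred

/-! ### Primitive recursive integer arithmetic. -/

namespace Primrec

open Encodable

/-- The encoding of `ℤ` interleaves signs: `n` goes to `2n` and `-(n+1)` to `2n+1`. Only this lemma,
`int_ofNat_sub` and `int_neg` look at it; the other operations split an integer into its positive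
and negative parts. -/
theorem int_toNat : Primrec Int.toNat := by
  have h : Primrec fun n : ℕ => if n % 2 = 0 then n / 2 else 0 :=
    Primrec.ite (Primrec.eq.comp (Primrec.nat_mod.comp Primrec.id (Primrec.const 2))
      (Primrec.const 0)) (Primrec.nat_div.comp Primrec.id (Primrec.const 2)) (Primrec.const 0)
  refine (h.comp (Primrec.encode (α := ℤ))).of_eq fun z => ?_
  cases z with
  | ofNat n =>
    have : encode (Int.ofNat n) = 2 * n := rfl
    rw [this]; simp
  | negSucc n =>
    have : encode (Int.negSucc n) = 2 * n + 1 := rfl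
    rw [this]; simp

theorem int_ofNat_sub : Primrec₂ fun a b : ℕ => (a : ℤ) - b := by
  have h : Primrec₂ fun a b : ℕ => if b ≤ a then 2 * (a - b) else 2 * (b - a - 1) + 1 := by
    refine Primrec.ite (Primrec.nat_le.comp Primrec.snd Primrec.fst) ?_ ?_
    · exact Primrec.nat_mul.comp (Primrec.const 2) (Primrec.nat_sub.comp Primrec.fst Primrec.snd)
    · exact Primrec.succ.comp (Primrec.nat_mul.comp (Primrec.const 2) (Primrec.nat_sub.comp
        (Primrec.nat_sub.comp Primrec.snd Primrec.fst) (Primrec.const 1)))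
  refine Primrec₂.encode_iff.1 (h.of_eq fun a b => ?_)
  split_ifs with hab
  · obtain ⟨k, rfl⟩ := Nat.exists_eq_add_of_le hab
    have : ((b + k : ℕ) : ℤ) - b = Int.ofNat k := by simp
    rw [this]
    have : encode (Int.ofNat k) = 2 * k := rfl
    rw [this]; simp
  · obtain ⟨k, rfl⟩ := Nat.exists_eq_add_of_lt (not_le.1 hab)
    have : (a : ℤ) - ((a + k + 1 : ℕ) : ℤ) = Int.negSucc k := by
      rw [Int.negSucc_eq]; push_cast; ring
    rw [this]
    have : encode (Int.negSucc k) = 2 * k + 1 := rfl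
    rw [this]; congr 2; omega

theorem int_neg : Primrec fun z : ℤ => -z := by
  have h2 : Primrec fun z : ℤ => (encode z + 1) / 2 := Primrec.nat_div.comp
      (Primrec.succ.comp Primrec.encode) (Primrec.const 2)
  have h3 : Primrec fun z : ℤ => (if encode z % 2 = 0 then 0 else (encode z + 1) / 2 : ℕ) :=
    Primrec.ite (Primrec.eq.comp (Primrec.nat_mod.comp Primrec.encode (Primrec.const 2))
      (Primrec.const 0)) (Primrec.const 0) h2
  refine (int_ofNat_sub.comp h3 int_toNat).of_eq fun z => ?_
  cases z with
  | ofNat n =>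
    have : encode (Int.ofNat n) = 2 * n := rfl
    rw [this]; simp
  | negSucc n =>
    have : encode (Int.negSucc n) = 2 * n + 1 := rfl
    rw [this, Int.negSucc_eq]
    have h : (2 * n + 1 + 1) / 2 = n + 1 := by omega
    have h' : ¬ (2 * n + 1) % 2 = 0 := by omega
    have h'' : (-((n : ℤ) + 1)).toNat = 0 := by omega
    rw [if_neg h', h, h'']; push_cast; ring

theorem int_add : Primrec₂ fun a b : ℤ => a + b := by
  refine (int_ofNat_sub.comp
    (Primrec.nat_add.comp (int_toNat.comp Primrec.fst) (int_toNat.comp Primrec.snd))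
    (Primrec.nat_add.comp (int_toNat.comp (int_neg.comp Primrec.fst))
      (int_toNat.comp (int_neg.comp Primrec.snd)))).of_eq fun x => ?_
  dsimp only
  omega

theorem int_mul : Primrec₂ fun a b : ℤ => a * b := by
  refine (int_ofNat_sub.comp
    (Primrec.nat_add.comp
      (Primrec.nat_mul.comp (int_toNat.comp Primrec.fst) (int_toNat.comp Primrec.snd))
      (Primrec.nat_mul.comp (int_toNat.comp (int_neg.comp Primrec.fst))
        (int_toNat.comp (int_neg.comp Primrec.snd))))
    (Primrec.nat_add.comp
      (Primrec.nat_mul.comp (int_toNat.comp Primrec.fst)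
        (int_toNat.comp (int_neg.comp Primrec.snd)))
      (Primrec.nat_mul.comp (int_toNat.comp (int_neg.comp Primrec.fst))
        (int_toNat.comp Primrec.snd)))).of_eq fun x => ?_
  obtain ⟨a, b⟩ := x
  dsimp only
  have ha : a = (a.toNat : ℤ) - ((-a).toNat : ℤ) := by omega
  have hb : b = (b.toNat : ℤ) - ((-b).toNat : ℤ) := by omega
  push_cast
  conv_rhs => rw [ha, hb]
  ring

theorem int_ofNat : Primrec fun n : ℕ => (n : ℤ) :=
  (int_ofNat_sub.comp Primrec.id (Primrec.const 0)).of_eq fun n => by simp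

theorem int_natAbs : Primrec Int.natAbs :=
  (Primrec.nat_add.comp int_toNat (int_toNat.comp int_neg)).of_eq fun z => by omega

theorem int_lt : PrimrecRel fun a b : ℤ => a < b := by
  refine (Primrec.nat_lt.comp
    (Primrec.nat_add.comp (int_toNat.comp Primrec.fst) (int_toNat.comp (int_neg.comp Primrec.snd)))
    (Primrec.nat_add.comp (int_toNat.comp Primrec.snd)
      (int_toNat.comp (int_neg.comp Primrec.fst)))).of_eq fun x => ?_
  omega

end Primrec

/-! ### Enumerating normal closures in free groups. -/

namespace FreeGroup

variable {α : Type*}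

section Primrec

variable [Primcodable α]

/-- Reduction is a right fold whose step either cancels the new letter against the head of the
reduced tail or prepends it. -/
theorem primrec_reduce [DecidableEq α] : Primrec (reduce (α := α)) := by
  have hx : Primrec fun z : (List (α × Bool) × ((α × Bool) × List (α × Bool))) ×
      ((α × Bool) × List (α × Bool)) => z.1.2.1 :=
    Primrec.fst.comp (Primrec.snd.comp Primrec.fst)
  have hy : Primrec fun z : (List (α × Bool) × ((α × Bool) × List (α × Bool))) ×
      ((α × Bool) × List (α × Bool)) => z.2.1 := Primrec.fst.comp Primrec.snd
  have hys : Primrec fun z : (List (α × Bool) × ((α × Bool) × List (α × Bool))) ×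
      ((α × Bool) × List (α × Bool)) => z.2.2 := Primrec.snd.comp Primrec.snd
  have hcons : Primrec fun z : (List (α × Bool) × ((α × Bool) × List (α × Bool))) ×
      ((α × Bool) × List (α × Bool)) =>
        if z.1.2.1.1 = z.2.1.1 ∧ z.1.2.1.2 = !z.2.1.2 then z.2.2 else z.1.2.1 :: z.2.1 :: z.2.2 :=
    Primrec.ite (PrimrecPred.and (Primrec.eq.comp (Primrec.fst.comp hx) (Primrec.fst.comp hy))
      (Primrec.eq.comp (Primrec.snd.comp hx) (Primrec.not.comp (Primrec.snd.comp hy)))) hys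
      (Primrec.list_cons.comp hx (Primrec.list_cons.comp hy hys))
  have hnil : Primrec fun p : List (α × Bool) × ((α × Bool) × List (α × Bool)) => [p.2.1] :=
    Primrec.list_cons.comp (Primrec.fst.comp Primrec.snd) (Primrec.const [])
  have hstep : Primrec₂ fun (_ : List (α × Bool)) (p : (α × Bool) × List (α × Bool)) =>
      (List.casesOn p.2 [p.1] fun y ys =>
        if p.1.1 = y.1 ∧ p.1.2 = !y.2 then ys else p.1 :: y :: ys : List (α × Bool)) :=
    Primrec.list_casesOn (Primrec.snd.comp Primrec.snd) hnil hcons.to₂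
  refine (Primrec.list_foldr Primrec.id (Primrec.const []) hstep).of_eq fun L => ?_
  induction L with
  | nil => rfl
  | cons x L ih =>
    simp only [id_eq, List.foldr_cons] at ih ⊢
    rw [ih]
    cases h : reduce L <;> rw [reduce.cons, h]

theorem primrec_invRev : Primrec (invRev (α := α)) := by
  unfold invRev
  exact Primrec.list_reverse.comp (Primrec.list_map Primrec.id
    ((Primrec.fst.comp Primrec.snd).pair (Primrec.not.comp (Primrec.snd.comp Primrec.snd))).to₂)

end Primrec

/-- The word `u r u⁻¹` or `u r⁻¹ u⁻¹`, depending on the sign `e`, for a triple `(u, e, r)`. -/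
def conjWord (c : List (α × Bool) × Bool × List (α × Bool)) : List (α × Bool) :=
  c.1 ++ (bif c.2.1 then c.2.2 else invRev c.2.2) ++ invRev c.1

theorem mk_conjWord (c : List (α × Bool) × Bool × List (α × Bool)) :
    mk (conjWord c) = mk c.1 * (bif c.2.1 then mk c.2.2 else (mk c.2.2)⁻¹) * (mk c.1)⁻¹ := by
  obtain ⟨u, e, r⟩ := c
  cases e <;> simp [conjWord, inv_mk, mul_mk]

theorem primrec_conjWord [Primcodable α] : Primrec (conjWord (α := α)) :=
  Primrec.list_append.comp
    (Primrec.list_append.comp Primrec.fst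
      (Primrec.cond (Primrec.fst.comp Primrec.snd) (Primrec.snd.comp Primrec.snd)
        (primrec_invRev.comp (Primrec.snd.comp Primrec.snd))))
    (primrec_invRev.comp Primrec.fst)

theorem mk_flatMap_conjWord (l : List (List (α × Bool) × Bool × List (α × Bool))) :
    mk (l.flatMap conjWord) = (l.map fun c => mk (conjWord c)).prod := by
  induction l with
  | nil => rfl
  | cons c l ih => rw [List.flatMap_cons, ← mul_mk, ih, List.map_cons, List.prod_cons]

/-- A normal closure consists of the products of conjugates of relators and their inverses.
Recording the conjugating words, signs and relators in a list makes such a product a finite object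
that can be searched for. -/
theorem mem_normalClosure_iff_exists_list (R : List (α × Bool) → Prop) (x : FreeGroup α) :
    x ∈ Subgroup.normalClosure {y : FreeGroup α | ∃ r, R r ∧ mk r = y} ↔
      ∃ l : List (List (α × Bool) × Bool × List (α × Bool)),
        (∀ c ∈ l, R c.2.2) ∧ mk (l.flatMap conjWord) = x := by
  set s := {y : FreeGroup α | ∃ r, R r ∧ mk r = y}
  constructor
  · intro hx
    unfold Subgroup.normalClosure at hx
    induction hx using Subgroup.closure_induction_left with
    | one => exact ⟨[], by simp, rfl⟩
    | mul_left y hy z hz ih =>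
      obtain ⟨l, hl, rfl⟩ := ih
      obtain ⟨_, ⟨r, hr, rfl⟩, hc⟩ := Group.mem_conjugatesOfSet_iff.1 hy
      obtain ⟨u, rfl⟩ := isConj_iff.1 hc
      obtain ⟨u, rfl⟩ : ∃ v, mk v = u := Quot.exists_rep u
      refine ⟨(u, true, r) :: l, ?_, ?_⟩
      · exact List.forall_mem_cons.2 ⟨hr, hl⟩
      · rw [List.flatMap_cons, ← mul_mk, mk_conjWord]
        rfl
    | inv_mul_cancel y hy z hz ih =>
      obtain ⟨l, hl, rfl⟩ := ih
      obtain ⟨_, ⟨r, hr, rfl⟩, hc⟩ := Group.mem_conjugatesOfSet_iff.1 hy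
      obtain ⟨u, rfl⟩ := isConj_iff.1 hc
      obtain ⟨u, rfl⟩ : ∃ v, mk v = u := Quot.exists_rep u
      refine ⟨(u, false, r) :: l, ?_, ?_⟩
      · exact List.forall_mem_cons.2 ⟨hr, hl⟩
      · rw [List.flatMap_cons, ← mul_mk, mk_conjWord, mul_inv_rev, mul_inv_rev, inv_inv]
        simp only [cond_false, mul_assoc]
  · rintro ⟨l, hl, rfl⟩
    rw [mk_flatMap_conjWord]
    refine Subgroup.list_prod_mem _ fun y hy => ?_
    obtain ⟨c, hc, rfl⟩ := List.mem_map.1 hy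
    have h : mk c.2.2 ∈ Subgroup.normalClosure s :=
      Subgroup.subset_normalClosure ⟨_, hl c hc, rfl⟩
    rw [mk_conjWord]
    refine Subgroup.normalClosure_normal.conj_mem _ ?_ _
    cases c.2.1
    · exact inv_mem h
    · exact h

/-- The consequences of a recursively enumerable family of relators form a recursively enumerable
set of words, uniformly in the family. -/
theorem rePred_mk_mem_normalClosure [Primcodable α] {δ : Type*} [Primcodable δ]
    {R : δ × List (α × Bool) → Prop} (hR : REPred R) :
    REPred fun x : δ × List (α × Bool) =>
      mk x.2 ∈ Subgroup.normalClosure {y : FreeGroup α | ∃ r, R (x.1, r) ∧ mk r = y} := by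
  classical
  have h1 : REPred fun x : (δ × List (α × Bool)) ×
      List (List (α × Bool) × Bool × List (α × Bool)) => ∀ c ∈ x.2, R (x.1.1, c.2.2) :=
    (REPred.forall_mem_list (p := fun y : (δ × List (α × Bool)) ×
      (List (α × Bool) × Bool × List (α × Bool)) => R (y.1.1, y.2.2.2))
      (hR.comp ((Primrec.fst.comp Primrec.fst).pair
        (Primrec.snd.comp (Primrec.snd.comp Primrec.snd))).to_comp))
  have h2 : REPred fun x : (δ × List (α × Bool)) ×
      List (List (α × Bool) × Bool × List (α × Bool)) =>
        reduce (x.2.flatMap conjWord) = reduce x.1.2 :=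
    (PrimrecPred.computablePred (Primrec.eq.comp
      (primrec_reduce.comp (Primrec.list_flatMap Primrec.snd (primrec_conjWord.comp Primrec.snd).to₂))
      (primrec_reduce.comp (Primrec.snd.comp Primrec.fst)))).to_re
  refine (REPred.exists_snd (h1.and h2)).of_eq fun x => ?_
  rw [mem_normalClosure_iff_exists_list]
  refine exists_congr fun l => and_congr_right fun _ => ?_
  -- Equality in the free group is decidable because it is equality of reduced words.
  exact ⟨reduce.exact, fun h => by
    rw [← toWord_mk, ← toWord_mk, h]⟩

end FreeGroup

/-! ### Semi-decidability of triviality and of normal closures in `G`. -/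

namespace MarkedGroup

variable {G : Type*} {S : Finset G}

/-- A word in the letters `S`, seen as a word in the letters `S` and their formal inverses. -/
def freeWord (w : List S) : List (S × Bool) := w.map fun s => (s, true)

theorem primrec_freeWord : Primrec (freeWord (S := S)) :=
  Primrec.list_map Primrec.id (Primrec.snd.pair (Primrec.const true)).to₂

variable [Group G]

theorem lift_mk_freeWord (w : List S) :
    FreeGroup.lift (Subtype.val : S → G) (FreeGroup.mk (freeWord w)) = eval w := by
  simp [freeWord, eval, FreeGroup.lift_mk, Function.comp_def]

theorem lift_surjective (hgen : Subgroup.closure (S : Set G) = ⊤) :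
    Function.Surjective (FreeGroup.lift (Subtype.val : S → G)) := by
  rw [← MonoidHom.range_eq_top, FreeGroup.range_lift_eq_closure]
  simpa using hgen

/-- Adding `w` to the relators presents the quotient by the normal closure of `eval w`: since the
free group maps onto `G`, normal closures map to normal closures, and the ambiguity of a lift lies
in the kernel, which the enlarged closure contains. -/
theorem eval_mem_normalClosure_iff (hgen : Subgroup.closure (S : Set G) = ⊤)
    {R : List (S × Bool) → Prop}
    (hR : (FreeGroup.lift (Subtype.val : S → G)).ker =
      Subgroup.normalClosure {x : FreeGroup S | ∃ r, R r ∧ FreeGroup.mk r = x}) (v w : List S) :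
    eval v ∈ Subgroup.normalClosure {eval w} ↔
      FreeGroup.mk (freeWord v) ∈ Subgroup.normalClosure
        {x : FreeGroup S | ∃ r, (R r ∨ r = freeWord w) ∧ FreeGroup.mk r = x} := by
  set N := Subgroup.normalClosure
        {x : FreeGroup S | ∃ r, (R r ∨ r = freeWord w) ∧ FreeGroup.mk r = x}
  have hker : (FreeGroup.lift (Subtype.val : S → G)).ker ≤ N := by
    rw [hR]
    refine Subgroup.normalClosure_mono ?_
    rintro x ⟨r, hr, rfl⟩
    exact ⟨r, Or.inl hr, rfl⟩
  have hmap := Subgroup.map_normalClosure {FreeGroup.mk (freeWord w)}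
    (FreeGroup.lift (Subtype.val : S → G)) (lift_surjective hgen)
  rw [Set.image_singleton, lift_mk_freeWord] at hmap
  constructor
  · intro hv
    rw [← hmap, ← lift_mk_freeWord v] at hv
    obtain ⟨y, hy, hyv⟩ := hv
    have hyN : y ∈ N := by
      refine Subgroup.normalClosure_mono ?_ hy
      rintro x rfl
      exact ⟨_, Or.inr rfl, rfl⟩
    have : FreeGroup.mk (freeWord v) * y⁻¹ ∈ N := by
      apply hker
      rw [MonoidHom.mem_ker, map_mul, map_inv, hyv, mul_inv_cancel]
    simpa using mul_mem this hyN
  · intro hv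
    rw [← lift_mk_freeWord v, ← Subgroup.mem_comap]
    refine Subgroup.normalClosure_le_normal ?_ hv
    rintro x ⟨r, hr | rfl, rfl⟩
    · have : FreeGroup.mk r ∈ (FreeGroup.lift (Subtype.val : S → G)).ker := by
        rw [hR]; exact Subgroup.subset_normalClosure ⟨r, hr, rfl⟩
      rw [SetLike.mem_coe, Subgroup.mem_comap, MonoidHom.mem_ker.1 this]
      exact one_mem _
    · rw [SetLike.mem_coe, Subgroup.mem_comap, lift_mk_freeWord]
      exact Subgroup.subset_normalClosure rfl

/-- In a recursively presented group, membership of words in the normal closure of the element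
represented by a word is uniformly semi-decidable. -/
theorem IsRecursivelyPresented.rePred_eval_mem_normalClosure
    (hgen : Subgroup.closure (S : Set G) = ⊤) (hpres : IsRecursivelyPresented S) :
    REPred fun x : List S × List S => eval x.2 ∈ Subgroup.normalClosure {eval x.1} := by
  classical
  obtain ⟨R, hR, hker⟩ := hpres
  have h1 : REPred fun x : List S × List (S × Bool) => R x.2 ∨ x.2 = freeWord x.1 :=
    (hR.comp Computable.snd).or (PrimrecPred.computablePred
      (Primrec.eq.comp Primrec.snd (primrec_freeWord.comp Primrec.fst))).to_re
  refine ((FreeGroup.rePred_mk_mem_normalClosure h1).comp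
    (Primrec.fst.pair (primrec_freeWord.comp Primrec.snd)).to_comp).of_eq fun x => ?_
  exact (eval_mem_normalClosure_iff hgen hker x.2 x.1).symm

theorem IsRecursivelyPresented.rePred_eval_eq_one
    (hgen : Subgroup.closure (S : Set G) = ⊤) (hpres : IsRecursivelyPresented S) :
    REPred fun w : List S => eval w = 1 := by
  -- The empty word is used as the extra relator; its normal closure is trivial.
  refine ((hpres.rePred_eval_mem_normalClosure hgen).comp
    ((Computable.const []).pair Computable.id)).of_eq fun w => ?_
  have : Subgroup.normalClosure {(1 : G)} = ⊥ :=
    le_bot_iff.1 (Subgroup.normalClosure_le_normal (by simp))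
  simp [eval, this]

end MarkedGroup

/-! ### Rational and algebraic numbers: semi-deciding strict upper bounds. -/

namespace MarkedGroup

namespace RatCode

/-- Addition of codes of rational numbers. -/
def add (c d : RatCode) : RatCode :=
  (c.1 * ((d.2 + 1 : ℕ) : ℤ) + d.1 * ((c.2 + 1 : ℕ) : ℤ), c.2 * d.2 + c.2 + d.2)

/-- Multiplication of codes of rational numbers. -/
def mul (c d : RatCode) : RatCode := (c.1 * d.1, c.2 * d.2 + c.2 + d.2)

/-- Comparison of codes of rational numbers. -/
def Lt (c d : RatCode) : Prop := c.1 * ((d.2 + 1 : ℕ) : ℤ) < d.1 * ((c.2 + 1 : ℕ) : ℤ)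

theorem toRat_add (c d : RatCode) : toRat (add c d) = toRat c + toRat d := by
  have h1 : (c.2 : ℚ) + 1 ≠ 0 := by positivity
  have h2 : (d.2 : ℚ) + 1 ≠ 0 := by positivity
  -- Codes store the denominator minus one, so this is the product of the denominators.
  have h3 : (c.2 : ℚ) * d.2 + c.2 + d.2 + 1 = (c.2 + 1) * (d.2 + 1) := by ring
  simp only [toRat, add]
  push_cast
  rw [h3]
  field_simp

theorem toRat_mul (c d : RatCode) : toRat (mul c d) = toRat c * toRat d := by
  have h1 : (c.2 : ℚ) + 1 ≠ 0 := by positivity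
  have h2 : (d.2 : ℚ) + 1 ≠ 0 := by positivity
  have h3 : (c.2 : ℚ) * d.2 + c.2 + d.2 + 1 = (c.2 + 1) * (d.2 + 1) := by ring
  simp only [toRat, mul]
  push_cast
  rw [h3]
  field_simp

theorem lt_iff (c d : RatCode) : Lt c d ↔ toRat c < toRat d := by
  have h1 : (0 : ℚ) < (c.2 : ℚ) + 1 := by positivity
  have h2 : (0 : ℚ) < (d.2 : ℚ) + 1 := by positivity
  rw [toRat, toRat, div_lt_div_iff₀ h1 h2, Lt]
  exact_mod_cast Iff.rfl

theorem primrec_add : Primrec₂ add := by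
  have hs : Primrec fun x : RatCode × RatCode => ((x.1.2 + 1 : ℕ) : ℤ) :=
    Primrec.int_ofNat.comp (Primrec.succ.comp (Primrec.snd.comp Primrec.fst))
  have ht : Primrec fun x : RatCode × RatCode => ((x.2.2 + 1 : ℕ) : ℤ) :=
    Primrec.int_ofNat.comp (Primrec.succ.comp (Primrec.snd.comp Primrec.snd))
  exact (Primrec.int_add.comp
    (Primrec.int_mul.comp (Primrec.fst.comp Primrec.fst) ht)
    (Primrec.int_mul.comp (Primrec.fst.comp Primrec.snd) hs)).pair
    (Primrec.nat_add.comp (Primrec.nat_add.comp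
      (Primrec.nat_mul.comp (Primrec.snd.comp Primrec.fst) (Primrec.snd.comp Primrec.snd))
      (Primrec.snd.comp Primrec.fst)) (Primrec.snd.comp Primrec.snd))

theorem primrec_mul : Primrec₂ mul :=
  (Primrec.int_mul.comp (Primrec.fst.comp Primrec.fst) (Primrec.fst.comp Primrec.snd)).pair
    (Primrec.nat_add.comp (Primrec.nat_add.comp
      (Primrec.nat_mul.comp (Primrec.snd.comp Primrec.fst) (Primrec.snd.comp Primrec.snd))
      (Primrec.snd.comp Primrec.fst)) (Primrec.snd.comp Primrec.snd))

theorem primrecRel_lt : PrimrecRel Lt := by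
  have hs : Primrec fun x : RatCode × RatCode => ((x.1.2 + 1 : ℕ) : ℤ) :=
    Primrec.int_ofNat.comp (Primrec.succ.comp (Primrec.snd.comp Primrec.fst))
  have ht : Primrec fun x : RatCode × RatCode => ((x.2.2 + 1 : ℕ) : ℤ) :=
    Primrec.int_ofNat.comp (Primrec.succ.comp (Primrec.snd.comp Primrec.snd))
  exact Primrec.int_lt.comp
    (Primrec.int_mul.comp (Primrec.fst.comp Primrec.fst) ht)
    (Primrec.int_mul.comp (Primrec.fst.comp Primrec.snd) hs)

end RatCode

/-- The code of the value at (the number coded by) `t` of the polynomial with coefficients `P`. -/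
def evalCode (P : List RatCode) (t : RatCode) : RatCode :=
  P.foldr (fun c acc => RatCode.add c (RatCode.mul t acc)) (0, 0)

theorem toRat_evalCode (P : List RatCode) (t : RatCode) :
    (evalCode P t).toRat = (polyOfList P).eval t.toRat := by
  induction P with
  | nil => simp [evalCode, polyOfList, RatCode.toRat]
  | cons c P ih =>
    rw [polyOfList, Polynomial.eval_add, Polynomial.eval_mul, Polynomial.eval_C,
      Polynomial.eval_X, ← ih, ← RatCode.toRat_mul, ← RatCode.toRat_add]
    rfl

theorem primrec_evalCode : Primrec₂ evalCode :=
  Primrec.list_foldr Primrec.fst (Primrec.const (0, 0))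
    (RatCode.primrec_add.comp (Primrec.fst.comp Primrec.snd)
      (RatCode.primrec_mul.comp (Primrec.snd.comp Primrec.fst)
        (Primrec.snd.comp Primrec.snd))).to₂

/-- A bound and a Lipschitz constant on `[-M, M]` for the polynomial with coefficients `P`. -/
def boundLip (P : List RatCode) (M : ℕ) : ℕ × ℕ :=
  P.foldr (fun c acc => (c.1.natAbs + M * acc.1, M * acc.2 + acc.1)) (0, 0)

theorem primrec_boundLip : Primrec₂ boundLip :=
  Primrec.list_foldr Primrec.fst (Primrec.const (0, 0))
    ((Primrec.nat_add.comp (Primrec.int_natAbs.comp (Primrec.fst.comp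
        (Primrec.fst.comp Primrec.snd)))
      (Primrec.nat_mul.comp (Primrec.snd.comp Primrec.fst)
        (Primrec.fst.comp (Primrec.snd.comp Primrec.snd)))).pair
      (Primrec.nat_add.comp (Primrec.nat_mul.comp (Primrec.snd.comp Primrec.fst)
        (Primrec.snd.comp (Primrec.snd.comp Primrec.snd)))
        (Primrec.fst.comp (Primrec.snd.comp Primrec.snd)))).to₂

theorem RatCode.toRat_int (z : ℤ) : RatCode.toRat (z, 0) = z := by
  simp [RatCode.toRat]

theorem RatCode.abs_toRat_le (c : RatCode) : |(c.toRat : ℝ)| ≤ c.1.natAbs := by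
  have h : (0 : ℝ) < (c.2 : ℝ) + 1 := by positivity
  rw [RatCode.toRat]
  push_cast
  rw [abs_div, abs_of_pos h]
  refine (div_le_self (abs_nonneg _) (by linarith [Nat.cast_nonneg (α := ℝ) c.2])).trans ?_
  rw [Nat.cast_natAbs, Int.cast_abs]

theorem abs_aeval_le (P : List RatCode) (M : ℕ) (x : ℝ) (hx : |x| ≤ M) :
    |Polynomial.aeval x (polyOfList P)| ≤ (boundLip P M).1 := by
  induction P with
  | nil => simp [boundLip, polyOfList]
  | cons c P ih =>
    have : (boundLip (c :: P) M).1 = c.1.natAbs + M * (boundLip P M).1 := rfl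
    rw [this, polyOfList, map_add, map_mul, Polynomial.aeval_C, Polynomial.aeval_X]
    push_cast
    refine (abs_add_le _ _).trans (add_le_add ?_ ?_)
    · have := c.abs_toRat_le
      simpa using this
    · rw [abs_mul]
      exact mul_le_mul hx ih (abs_nonneg _) (Nat.cast_nonneg _)

/-- Induction along Horner's scheme, with the discrete product rule `x p - y q = x (p - q) + (x - y)
q`; this is the recursion built into `boundLip`. -/
theorem abs_aeval_sub_le (P : List RatCode) (M : ℕ) (x y : ℝ) (hx : |x| ≤ M) (hy : |y| ≤ M) :
    |Polynomial.aeval x (polyOfList P) - Polynomial.aeval y (polyOfList P)| ≤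
      (boundLip P M).2 * |x - y| := by
  induction P with
  | nil => simp [boundLip, polyOfList]
  | cons c P ih =>
    have : (boundLip (c :: P) M).2 = M * (boundLip P M).2 + (boundLip P M).1 := rfl
    rw [this, polyOfList]
    simp only [map_add, map_mul, Polynomial.aeval_C, Polynomial.aeval_X]
    set p := Polynomial.aeval x (polyOfList P) with hp
    set q := Polynomial.aeval y (polyOfList P) with hq
    have h1 : ∀ z : ℝ, z + x * p - (z + y * q) = x * (p - q) + (x - y) * q := fun z => by ring
    rw [h1]
    push_cast
    refine (abs_add_le _ _).trans ?_
    rw [abs_mul, abs_mul, add_mul]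
    refine add_le_add ?_ ?_
    · rw [mul_assoc]
      exact mul_le_mul hx ih (abs_nonneg _) (Nat.cast_nonneg _)
    · rw [mul_comm]
      exact mul_le_mul_of_nonneg_right (abs_aeval_le P M y hy) (abs_nonneg _)

/-- The value at `t` of the polynomial with coefficients `P` exceeds by a factor more than
`1 / (K + 1)` its Lipschitz constant on `[-M, M]`. -/
def IsLargeAt (P : List RatCode) (M K : ℕ) (t : RatCode) : Prop :=
  (boundLip P M).2 * ((evalCode P t).2 + 1) < (evalCode P t).1.natAbs * (K + 1)

theorem primrecPred_isLargeAt : PrimrecPred fun x : (List RatCode × ℕ × ℕ) × RatCode =>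
    IsLargeAt x.1.1 x.1.2.1 x.1.2.2 x.2 := by
  have hP : Primrec fun x : (List RatCode × ℕ × ℕ) × RatCode => x.1.1 :=
    Primrec.fst.comp Primrec.fst
  have hE : Primrec fun x : (List RatCode × ℕ × ℕ) × RatCode => evalCode x.1.1 x.2 :=
    primrec_evalCode.comp hP Primrec.snd
  exact Primrec.nat_lt.comp
    (Primrec.nat_mul.comp (Primrec.snd.comp (primrec_boundLip.comp hP
      (Primrec.fst.comp (Primrec.snd.comp Primrec.fst)))) (Primrec.succ.comp (Primrec.snd.comp hE)))
    (Primrec.nat_mul.comp (Primrec.int_natAbs.comp (Primrec.fst.comp hE))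
      (Primrec.succ.comp (Primrec.snd.comp (Primrec.snd.comp Primrec.fst))))

/-- A certificate `(M, K, N)` that the polynomial with coefficients `P` has no root in `[q, b]`:
the interval is contained in `[-M, M]` and covered by `N` steps of length `1 / (K + 1)` from `q`
on, and at the beginning of each step the value of the polynomial is too large for it to have a
zero during the step. -/
def IsRootFreeCert (P : List RatCode) (q b : RatCode) (M K N : ℕ) : Prop :=
  (RatCode.Lt (-(M : ℤ), 0) q ∧ RatCode.Lt b ((M : ℤ), 0)) ∧
    RatCode.Lt b (RatCode.add q ((N : ℤ), K)) ∧
    ∀ t ∈ (List.range N).map fun i : ℕ => RatCode.add q ((i : ℤ), K), IsLargeAt P M K t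

theorem aeval_toRat (P : List RatCode) (t : RatCode) :
    Polynomial.aeval (t.toRat : ℝ) (polyOfList P) = ((evalCode P t).toRat : ℝ) := by
  rw [toRat_evalCode]
  have := Polynomial.aeval_algebraMap_apply ℝ t.toRat (polyOfList P)
  simpa using this

theorem isLargeAt_iff (P : List RatCode) (M K : ℕ) (t : RatCode) :
    IsLargeAt P M K t ↔
      ((boundLip P M).2 : ℝ) < |Polynomial.aeval (t.toRat : ℝ) (polyOfList P)| * (K + 1) := by
  have h : (0 : ℝ) < ((evalCode P t).2 : ℝ) + 1 := by positivity
  rw [aeval_toRat, RatCode.toRat, IsLargeAt]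
  push_cast
  rw [abs_div, abs_of_pos h, div_mul_eq_mul_div, lt_div_iff₀ h, ← Int.cast_abs,
    ← Nat.cast_natAbs]
  exact_mod_cast Iff.rfl

theorem toRat_step (q : RatCode) (i K : ℕ) :
    ((RatCode.add q ((i : ℤ), K)).toRat : ℝ) = q.toRat + i / (K + 1) := by
  rw [RatCode.toRat_add]
  simp [RatCode.toRat]

theorem IsRootFreeCert.aeval_ne_zero {P : List RatCode} {q b : RatCode} {M K N : ℕ}
    (h : IsRootFreeCert P q b M K N) {x : ℝ} (hx : x ∈ Set.Icc (q.toRat : ℝ) (b.toRat : ℝ)) :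
    Polynomial.aeval x (polyOfList P) ≠ 0 := by
  obtain ⟨⟨h1, h2⟩, h3, h4⟩ := h
  simp only [RatCode.lt_iff] at h1 h2 h3
  have h1' : ((RatCode.toRat (-(M : ℤ), 0) : ℚ) : ℝ) < (q.toRat : ℝ) := by exact_mod_cast h1
  have h2' : (b.toRat : ℝ) < ((RatCode.toRat ((M : ℤ), 0) : ℚ) : ℝ) := by exact_mod_cast h2
  have h3' : (b.toRat : ℝ) < ((RatCode.add q ((N : ℤ), K)).toRat : ℝ) := by exact_mod_cast h3
  rw [toRat_step] at h3'
  rw [RatCode.toRat_int] at h1' h2'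
  push_cast at h1' h2'
  set r : ℝ := (q.toRat : ℝ) with hr
  have hK : (0 : ℝ) < (K : ℝ) + 1 := by positivity
  have hxr : 0 ≤ (x - r) * (K + 1) := mul_nonneg (by linarith [hx.1]) hK.le
  -- The index of the grid step containing `x`. A zero at `x` would bound the value at the start of
  -- that step by the Lipschitz constant over `K + 1`, contrary to `IsLargeAt`.
  set i := ⌊(x - r) * (K + 1)⌋₊ with hi
  have hi1 : (i : ℝ) / (K + 1) ≤ x - r := by
    rw [div_le_iff₀ hK]; exact Nat.floor_le hxr
  have hi2 : x - r < i / (K + 1) + 1 / (K + 1) := by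
    rw [← add_div, lt_div_iff₀ hK]; exact Nat.lt_floor_add_one _
  have hi0 : (0 : ℝ) ≤ i / (K + 1) := by positivity
  have hiN : i < N := by
    have : (i : ℝ) / (K + 1) < N / (K + 1) := by linarith [hx.2]
    rw [div_lt_div_iff_of_pos_right hK] at this
    exact_mod_cast this
  have h5 := (isLargeAt_iff _ _ _ _).1 (h4 _ (List.mem_map_of_mem (List.mem_range.2 hiN)))
  rw [toRat_step] at h5
  intro h0
  have h6 := abs_aeval_sub_le P M (r + i / (K + 1)) x
    (abs_le.2 ⟨by linarith, by linarith [hx.2]⟩) (abs_le.2 ⟨by linarith [hx.1], by linarith [hx.2]⟩)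
  rw [h0, sub_zero] at h6
  have h7 : |r + i / (K + 1) - x| ≤ 1 / (K + 1) := abs_le.2 ⟨by linarith, by
    have : (0 : ℝ) ≤ 1 / (K + 1) := by positivity
    linarith⟩
  have h8 := h6.trans (mul_le_mul_of_nonneg_left h7 (Nat.cast_nonneg _))
  rw [mul_one_div, le_div_iff₀ hK] at h8
  linarith

/-- By compactness `|P|` has a positive minimum on the interval, so a fine enough grid passes the
Lipschitz test at each of its points. -/
theorem exists_isRootFreeCert {P : List RatCode} {q b : RatCode}
    (h : ∀ x ∈ Set.Icc (q.toRat : ℝ) (b.toRat : ℝ), Polynomial.aeval x (polyOfList P) ≠ 0) :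
    ∃ M K N, IsRootFreeCert P q b M K N := by
  obtain ⟨M, hM⟩ := exists_nat_gt (max |q.toRat| |b.toRat|)
  have hMq : RatCode.Lt (-(M : ℤ), 0) q := by
    rw [RatCode.lt_iff]
    have := (abs_lt.1 ((le_max_left _ _).trans_lt hM)).1
    simpa [RatCode.toRat] using this
  have hMb : RatCode.Lt b ((M : ℤ), 0) := by
    rw [RatCode.lt_iff]
    have := (abs_lt.1 ((le_max_right _ _).trans_lt hM)).2
    simpa [RatCode.toRat] using this
  by_cases hqb : b.toRat < q.toRat
  · refine ⟨M, 0, 0, ⟨hMq, hMb⟩, ?_, by simp⟩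
    rw [RatCode.lt_iff, RatCode.toRat_add]
    simpa [RatCode.toRat] using hqb
  · have hqb' : (q.toRat : ℝ) ≤ (b.toRat : ℝ) := by exact_mod_cast not_lt.1 hqb
    obtain ⟨z, hz, hmin⟩ := isCompact_Icc.exists_isMinOn (Set.nonempty_Icc.2 hqb')
      (f := fun x : ℝ => |Polynomial.aeval x (polyOfList P)|)
      (Polynomial.continuous_aeval _).abs.continuousOn
    set δ := |Polynomial.aeval z (polyOfList P)| with hδ
    have hδ0 : 0 < δ := abs_pos.2 (h z hz)
    obtain ⟨K, hK⟩ := exists_nat_gt (((boundLip P M).2 : ℝ) / δ)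
    have hK0 : (0 : ℝ) < (K : ℝ) + 1 := by positivity
    -- The grid point of index `N` is beyond `b`, while those of index below `N` are still in the
    -- interval, where the minimum applies.
    set N := ⌊((b.toRat : ℝ) - q.toRat) * (K + 1)⌋₊ + 1 with hN
    refine ⟨M, K, N, ⟨hMq, hMb⟩, ?_, fun t ht => ?_⟩
    · rw [RatCode.lt_iff]
      have h1 : (b.toRat : ℝ) < ((RatCode.add q ((N : ℤ), K)).toRat : ℝ) := by
        rw [toRat_step, ← sub_lt_iff_lt_add', lt_div_iff₀ hK0, hN]
        push_cast
        exact Nat.lt_floor_add_one _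
      exact_mod_cast h1
    · obtain ⟨i, hi, rfl⟩ := List.mem_map.1 ht
      rw [isLargeAt_iff, toRat_step]
      have hi' : i ≤ ⌊((b.toRat : ℝ) - q.toRat) * (K + 1)⌋₊ := by
        have := List.mem_range.1 hi; omega
      have h1 : (i : ℝ) / (K + 1) ≤ b.toRat - q.toRat := by
        rw [div_le_iff₀ hK0]
        exact (Nat.cast_le.2 hi').trans (Nat.floor_le (mul_nonneg (by linarith) hK0.le))
      have h0 : (0 : ℝ) ≤ (i : ℝ) / (K + 1) := by positivity
      have h2 := isMinOn_iff.1 hmin (q.toRat + i / (K + 1)) ⟨by linarith, by linarith⟩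
      rw [div_lt_iff₀ hδ0] at hK
      calc ((boundLip P M).2 : ℝ) < K * δ := hK
        _ ≤ δ * (K + 1) := by nlinarith
        _ ≤ _ := mul_le_mul_of_nonneg_right h2 hK0.le

/-- As `y` is the only root in `[a, b]`, it lies below `q` exactly when `[q, b]` contains no root.
No sign change is needed, so multiple roots do no harm. -/
theorem AlgCode.Specifies.lt_iff {c : AlgCode} {y : ℝ} (h : c.Specifies y) (q : RatCode) :
    y < q.toRat ↔ ∃ M K N, IsRootFreeCert c.1 q c.2.2 M K N := by
  obtain ⟨-, h⟩ := h
  have hy : y ∈ ({y} : Set ℝ) := rfl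
  rw [← h] at hy
  constructor
  · intro hyq
    refine exists_isRootFreeCert fun x hx h0 => ?_
    have : x ∈ ({y} : Set ℝ) := by
      rw [← h]
      exact ⟨⟨hy.1.1.trans (hyq.le.trans hx.1), hx.2⟩, h0⟩
    rw [Set.mem_singleton_iff.1 this] at hx
    exact absurd hx.1 (not_le.2 hyq)
  · rintro ⟨M, K, N, hc⟩
    by_contra hyq
    exact hc.aeval_ne_zero ⟨not_lt.1 hyq, hy.1.2⟩ hy.2

theorem rePred_isRootFreeCert :
    REPred fun x : (AlgCode × RatCode) × (ℕ × ℕ × ℕ) =>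
      IsRootFreeCert x.1.1.1 x.1.2 x.1.1.2.2 x.2.1 x.2.2.1 x.2.2.2 := by
  have hq : Primrec fun x : (AlgCode × RatCode) × (ℕ × ℕ × ℕ) => x.1.2 :=
    Primrec.snd.comp Primrec.fst
  have hb : Primrec fun x : (AlgCode × RatCode) × (ℕ × ℕ × ℕ) => x.1.1.2.2 :=
    Primrec.snd.comp (Primrec.snd.comp (Primrec.fst.comp Primrec.fst))
  have hM : Primrec fun x : (AlgCode × RatCode) × (ℕ × ℕ × ℕ) => (x.2.1 : ℤ) :=
    Primrec.int_ofNat.comp (Primrec.fst.comp Primrec.snd)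
  have hK : Primrec fun x : (AlgCode × RatCode) × (ℕ × ℕ × ℕ) => x.2.2.1 :=
    Primrec.fst.comp (Primrec.snd.comp Primrec.snd)
  have hN : Primrec fun x : (AlgCode × RatCode) × (ℕ × ℕ × ℕ) => x.2.2.2 :=
    Primrec.snd.comp (Primrec.snd.comp Primrec.snd)
  refine REPred.and (REPred.and ?_ ?_) (REPred.and ?_ ?_)
  · exact (PrimrecPred.computablePred (RatCode.primrecRel_lt.comp
      ((Primrec.int_neg.comp hM).pair (Primrec.const 0)) hq)).to_re
  · exact (PrimrecPred.computablePred (RatCode.primrecRel_lt.comp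
      hb (hM.pair (Primrec.const 0)))).to_re
  · exact (PrimrecPred.computablePred (RatCode.primrecRel_lt.comp
      hb (RatCode.primrec_add.comp hq ((Primrec.int_ofNat.comp hN).pair hK)))).to_re
  · have hg : Primrec fun x : (AlgCode × RatCode) × (ℕ × ℕ × ℕ) =>
        (List.range x.2.2.2).map fun i : ℕ => RatCode.add x.1.2 ((i : ℤ), x.2.2.1) :=
      Primrec.list_map (Primrec.list_range.comp hN) (RatCode.primrec_add.comp (hq.comp Primrec.fst)
        ((Primrec.int_ofNat.comp Primrec.snd).pair (hK.comp Primrec.fst))).to₂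
    have hP : Primrec fun x : (AlgCode × RatCode) × (ℕ × ℕ × ℕ) => (x.1.1.1, x.2.1, x.2.2.1) :=
      (Primrec.fst.comp (Primrec.fst.comp Primrec.fst)).pair
        ((Primrec.fst.comp Primrec.snd).pair hK)
    have h := REPred.forall_mem_list (p := fun x : (List RatCode × ℕ × ℕ) × RatCode =>
      IsLargeAt x.1.1 x.1.2.1 x.1.2.2 x.2) primrecPred_isLargeAt.computablePred.to_re
    exact REPred.comp h (f := fun x : (AlgCode × RatCode) × (ℕ × ℕ × ℕ) =>
      ((x.1.1.1, x.2.1, x.2.2.1),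
        (List.range x.2.2.2).map fun i : ℕ => RatCode.add x.1.2 ((i : ℤ), x.2.2.1)))
      (hP.pair hg).to_comp

/-- The rational numbers above an upper semi-computable real number are semi-decidable. -/
theorem IsUpperSemicomputable.rePred_lt {x : ℝ} (hx : IsUpperSemicomputable x) :
    REPred fun q : RatCode => x < q.toRat := by
  obtain ⟨c, y, hc, hy, hanti, hlim⟩ := hx
  have h1 : REPred fun z : (RatCode × ℕ) × (ℕ × ℕ × ℕ) =>
      IsRootFreeCert (c z.1.2).1 z.1.1 (c z.1.2).2.2 z.2.1 z.2.2.1 z.2.2.2 :=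
    REPred.comp rePred_isRootFreeCert (f := fun z : (RatCode × ℕ) × (ℕ × ℕ × ℕ) =>
      ((c z.1.2, z.1.1), z.2)) (((hc.comp (Computable.snd.comp Computable.fst)).pair
      (Computable.fst.comp Computable.fst)).pair Computable.snd)
  have h2 := h1.exists_snd
  have h3 := h2.exists_snd
  refine h3.of_eq fun q => ?_
  -- Since the sequence decreases to `x`, a single term below `q` suffices.
  have h4 : x < q.toRat ↔ ∃ k, y k < q.toRat :=
    ⟨fun h => (hlim.eventually_lt_const h).exists,
      fun ⟨k, hk⟩ => (hanti.le_of_tendsto hlim k).trans_lt hk⟩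
  rw [h4]
  refine exists_congr fun k => ?_
  rw [(hy k).lt_iff q]
  simp

end MarkedGroup

/-! ### Finitely supported functions, words and moments of the walk. -/

namespace MarkedGroup

section FiniteSupport

variable {X : Type*}

/-- The inner product of finitely supported functions. -/
noncomputable def ip : LinearMap.BilinForm ℝ (X →₀ ℝ) :=
  LinearMap.mk₂ ℝ (fun F H => F.sum fun x a => a * H x)
    (fun F F' H => Finsupp.sum_add_index' (by simp) (by intros; ring))
    (fun c F H => by
      rw [Finsupp.sum_smul_index' (by simp), Finsupp.smul_sum]
      simp [mul_assoc])
    (fun F H H' => by simp [mul_add, Finsupp.sum_add])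
    (fun c F H => by
      rw [Finsupp.smul_sum]
      simp [mul_left_comm])

theorem ip_eq_sum {F : X →₀ ℝ} (H : X →₀ ℝ) {T : Finset X} (hT : F.support ⊆ T) :
    ip F H = ∑ x ∈ T, F x * H x :=
  Finsupp.sum_of_support_subset F hT (fun x a => a * H x) (by simp)

theorem ip_comm (F H : X →₀ ℝ) : ip F H = ip H F := by
  classical
  rw [ip_eq_sum H (Finset.subset_union_left (s₂ := H.support)),
    ip_eq_sum F (Finset.subset_union_right (s₁ := F.support))]
  exact Finset.sum_congr rfl fun x _ => mul_comm _ _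

theorem ip_self_nonneg (F : X →₀ ℝ) : 0 ≤ ip F F := by
  rw [ip_eq_sum F subset_rfl]
  exact Finset.sum_nonneg fun x _ => mul_self_nonneg _

theorem ip_sq_le (F H : X →₀ ℝ) : ip F H ^ 2 ≤ ip F F * ip H H := by
  have := LinearMap.BilinForm.apply_mul_apply_le_of_forall_zero_le (ip (X := X))
    ip_self_nonneg F H
  rwa [ip_comm H F, ← sq] at this

theorem ip_single_single [DecidableEq X] (x y : X) (a b : ℝ) :
    ip (Finsupp.single x a) (Finsupp.single y b) = if x = y then a * b else 0 := by
  rw [ip_eq_sum _ Finsupp.support_single_subset]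
  by_cases h : x = y
  · simp [h]
  · simp [h]

variable {G : Type*} [Group G] [MulAction G X]

/-- The permutation representation on finitely supported functions. -/
noncomputable def translate (g : G) : (X →₀ ℝ) →ₗ[ℝ] (X →₀ ℝ) :=
  Finsupp.lmapDomain ℝ ℝ (g • ·)

theorem translate_single (g : G) (x : X) (a : ℝ) :
    translate g (Finsupp.single x a) = Finsupp.single (g • x) a :=
  Finsupp.mapDomain_single

theorem translate_apply_smul (g : G) (F : X →₀ ℝ) (x : X) : translate g F (g • x) = F x :=
  Finsupp.mapDomain_apply (MulAction.injective g) F x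

theorem translate_apply (g : G) (F : X →₀ ℝ) (x : X) : translate g F x = F (g⁻¹ • x) := by
  conv_lhs => rw [← smul_inv_smul g x]
  exact translate_apply_smul g F _

theorem translate_one (F : X →₀ ℝ) : translate (1 : G) F = F := by
  ext x; rw [translate_apply, inv_one, one_smul]

theorem translate_mul (g h : G) (F : X →₀ ℝ) :
    translate (g * h) F = translate g (translate h F) := by
  ext x; rw [translate_apply, translate_apply, translate_apply, mul_inv_rev, mul_smul]

theorem ip_translate_translate (g : G) (F H : X →₀ ℝ) :
    ip (translate g F) (translate g H) = ip F H := by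
  change (Finsupp.mapDomain (g • ·) F).sum (fun x a => a * translate g H x) =
    F.sum fun x a => a * H x
  rw [Finsupp.sum_mapDomain_index (by simp) (by intros; ring)]
  exact Finset.sum_congr rfl fun x _ => by dsimp only; rw [translate_apply_smul]

theorem ip_translate_left (g : G) (F H : X →₀ ℝ) :
    ip (translate g F) H = ip F (translate g⁻¹ H) := by
  rw [← ip_translate_translate g F, ← translate_mul, mul_inv_cancel, translate_one]

end FiniteSupport

section Words

variable {G : Type*} (S : Finset G)

/-- Prefixing a letter to a word. -/
def consEmbedding : S × List S ↪ List S where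
  toFun p := p.1 :: p.2
  inj' p q h := by
    obtain ⟨h1, h2⟩ := List.cons_eq_cons.1 h
    exact Prod.ext h1 h2

/-- The words of length `n` in the letters `S`. -/
def words : ℕ → Finset (List S)
  | 0 => {[]}
  | n + 1 => (Finset.univ ×ˢ words n).map (consEmbedding S)

variable {S}

theorem mem_words {n : ℕ} {w : List S} : w ∈ words S n ↔ w.length = n := by
  induction n generalizing w with
  | zero => simp [words]
  | succ n ih =>
    simp only [words, Finset.mem_map, Finset.mem_product, Finset.mem_univ, true_and, ih]
    constructor
    · rintro ⟨p, hp, rfl⟩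
      exact congrArg (· + 1) hp
    · intro hw
      cases w with
      | nil => simp at hw
      | cons s w => exact ⟨(s, w), by simpa using hw, rfl⟩

theorem card_words (n : ℕ) : (words S n).card = S.card ^ n := by
  induction n with
  | zero => rfl
  | succ n ih => rw [words, Finset.card_map, Finset.card_product, ih]; simp [pow_succ']

theorem sum_words_succ {M : Type*} [AddCommMonoid M] (n : ℕ) (f : List S → M) :
    ∑ w ∈ words S (n + 1), f w = ∑ s : S, ∑ w ∈ words S n, f (s :: w) := by
  rw [words, Finset.sum_map, Finset.sum_product]
  rfl

variable [Group G]

theorem eval_cons (s : S) (w : List S) : eval (s :: w) = s * eval w := by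
  simp [eval]

theorem eval_append (v w : List S) : eval (v ++ w) = eval v * eval w := by
  simp [eval]

theorem exists_eval_eq_inv (hsymm : ∀ s ∈ S, s⁻¹ ∈ S) (w : List S) :
    ∃ v : List S, v.length = w.length ∧ eval v = (eval w)⁻¹ := by
  induction w with
  | nil => exact ⟨[], rfl, by simp [eval]⟩
  | cons s w ih =>
    obtain ⟨v, hv, hvw⟩ := ih
    refine ⟨v ++ [⟨(s : G)⁻¹, hsymm s s.2⟩], by simp [hv], ?_⟩
    rw [eval_append, eval_cons s w, mul_inv_rev, hvw]
    simp [eval]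

theorem exists_eval_eq (hsymm : ∀ s ∈ S, s⁻¹ ∈ S) (hgen : Subgroup.closure (S : Set G) = ⊤)
    (g : G) : ∃ w : List S, eval w = g := by
  have hg : g ∈ Subgroup.closure (S : Set G) := by rw [hgen]; trivial
  induction hg using Subgroup.closure_induction with
  | mem s hs => exact ⟨[⟨s, hs⟩], by simp [eval]⟩
  | one => exact ⟨[], rfl⟩
  | mul a b _ _ ha hb =>
    obtain ⟨v, rfl⟩ := ha
    obtain ⟨w, rfl⟩ := hb
    exact ⟨v ++ w, eval_append v w⟩
  | inv a _ ha =>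
    obtain ⟨v, rfl⟩ := ha
    obtain ⟨w, -, hw⟩ := exists_eval_eq_inv hsymm v
    exact ⟨w, hw⟩

end Words

section Walk

variable {G : Type*} [Group G] (S : Finset G) {X : Type*} [MulAction G X]

/-- The sum over the generators of the translations, on finitely supported functions. -/
noncomputable def adjacency : Module.End ℝ (X →₀ ℝ) := ∑ s : S, translate (s : G)

theorem adjacency_pow_apply (n : ℕ) (F : X →₀ ℝ) :
    (adjacency S ^ n) F = ∑ w ∈ words S n, translate (eval w) F := by
  induction n with
  | zero =>
    have : eval ([] : List S) = 1 := rfl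
    simp [words, this, translate_one]
  | succ n ih =>
    rw [pow_succ', Module.End.mul_apply, ih, sum_words_succ, adjacency, LinearMap.sum_apply]
    refine Finset.sum_congr rfl fun s _ => ?_
    rw [map_sum]
    exact Finset.sum_congr rfl fun w _ => by rw [eval_cons, translate_mul]

variable {S}

/-- The adjoint of translation by `s` is translation by `s⁻¹`, and inversion permutes `S`. -/
theorem ip_adjacency (hsymm : ∀ s ∈ S, s⁻¹ ∈ S) (F H : X →₀ ℝ) :
    ip (adjacency S F) H = ip F (adjacency S H) := by
  rw [adjacency, LinearMap.sum_apply, LinearMap.sum_apply, map_sum, map_sum, LinearMap.sum_apply]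
  refine Finset.sum_nbij' (fun s => ⟨(s : G)⁻¹, hsymm s s.2⟩) (fun s => ⟨(s : G)⁻¹, hsymm s s.2⟩)
    (by simp) (by simp) (by simp) (by simp) fun s _ => ?_
  exact ip_translate_left _ _ _

theorem ip_adjacency_pow (hsymm : ∀ s ∈ S, s⁻¹ ∈ S) (n : ℕ) (F H : X →₀ ℝ) :
    ip ((adjacency S ^ n) F) H = ip F ((adjacency S ^ n) H) := by
  induction n generalizing F with
  | zero => rfl
  | succ n ih =>
    rw [pow_succ, Module.End.mul_apply, ih, ip_adjacency hsymm, ← Module.End.mul_apply,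
      ← pow_succ', pow_succ]

theorem ip_adjacency_pow_pow (hsymm : ∀ s ∈ S, s⁻¹ ∈ S) (m n : ℕ) (F H : X →₀ ℝ) :
    ip ((adjacency S ^ m) F) ((adjacency S ^ n) H) = ip ((adjacency S ^ (m + n)) F) H := by
  rw [← ip_adjacency_pow hsymm, ← Module.End.mul_apply, ← pow_add, add_comm]

/-- Moments of even order of the walk on `X`, weighted by `F`. -/
noncomputable def moment (S : Finset G) (F : X →₀ ℝ) (n : ℕ) : ℝ :=
  ip ((adjacency S ^ n) F) ((adjacency S ^ n) F)

theorem moment_nonneg (F : X →₀ ℝ) (n : ℕ) : 0 ≤ moment S F n := ip_self_nonneg _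

theorem moment_zero (F : X →₀ ℝ) : moment S F 0 = ip F F := by
  rw [moment, pow_zero, Module.End.one_apply]

theorem moment_eq (hsymm : ∀ s ∈ S, s⁻¹ ∈ S) (F : X →₀ ℝ) (n : ℕ) :
    moment S F n = ip ((adjacency S ^ (2 * n)) F) F := by
  rw [moment, ip_adjacency_pow_pow hsymm, two_mul]

theorem moment_adjacency_pow (F : X →₀ ℝ) (m n : ℕ) :
    moment S ((adjacency S ^ n) F) m = moment S F (n + m) := by
  rw [moment, moment, ← Module.End.mul_apply, ← pow_add, add_comm]

/-- Self-adjointness followed by Cauchy–Schwarz. Log-convexity of the moments, their doubling and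
the control of odd return counts are all instances. -/
theorem ip_pow_add_sq_le (hsymm : ∀ s ∈ S, s⁻¹ ∈ S) (F : X →₀ ℝ) (m n : ℕ) :
    ip ((adjacency S ^ (m + n)) F) F ^ 2 ≤ moment S F m * moment S F n := by
  rw [← ip_adjacency_pow_pow hsymm]
  exact ip_sq_le _ _

theorem moment_add_sq_le (hsymm : ∀ s ∈ S, s⁻¹ ∈ S) (F : X →₀ ℝ) (m n : ℕ) :
    moment S F (m + n) ^ 2 ≤ moment S F (2 * m) * moment S F (2 * n) := by
  rw [moment_eq hsymm, mul_add]
  exact ip_pow_add_sq_le hsymm F _ _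

theorem moment_succ_sq_le (hsymm : ∀ s ∈ S, s⁻¹ ∈ S) (F : X →₀ ℝ) (n : ℕ) :
    moment S F (n + 1) ^ 2 ≤ moment S F n * moment S F (n + 2) := by
  have := ip_pow_add_sq_le hsymm F n (n + 2)
  rwa [show n + (n + 2) = 2 * (n + 1) by ring, ← moment_eq hsymm] at this

/-- Doubling: moments grow at least geometrically along powers of two. -/
theorem moment_pow_le (hsymm : ∀ s ∈ S, s⁻¹ ∈ S) {F : X →₀ ℝ} (hF : 0 < ip F F) (m i : ℕ) :
    (moment S F m / ip F F) ^ 2 ^ i ≤ moment S F (2 ^ i * m) / ip F F := by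
  induction i with
  | zero => simp
  | succ i ih =>
    have h1 := moment_add_sq_le hsymm F 0 (2 ^ i * m)
    rw [zero_add, mul_zero, moment_zero, ← mul_assoc, ← pow_succ'] at h1
    have h0 : 0 ≤ moment S F m / ip F F := div_nonneg (moment_nonneg _ _) hF.le
    calc (moment S F m / ip F F) ^ 2 ^ (i + 1)
        = ((moment S F m / ip F F) ^ 2 ^ i) ^ 2 := by rw [← pow_mul, pow_succ]
      _ ≤ (moment S F (2 ^ i * m) / ip F F) ^ 2 := pow_le_pow_left₀ (pow_nonneg h0 _) ih 2
      _ ≤ _ := by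
        rw [div_pow, div_le_div_iff₀ (by positivity) hF]
        nlinarith

/-- Expand `F` into point masses and bound the cross terms by Cauchy–Schwarz. The bound is crude,
but its prefactor does not depend on `n` and so is invisible on the exponential scale. -/
theorem moment_le_sum_abs (F : X →₀ ℝ) {n : ℕ} {c : ℝ}
    (hc : ∀ x : X, moment S (Finsupp.single x 1) n ≤ c) :
    moment S F n ≤ (∑ x ∈ F.support, |F x|) ^ 2 * c := by
  have hF : (adjacency S ^ n) F =
      ∑ x ∈ F.support, F x • (adjacency S ^ n) (Finsupp.single x 1) := by
    conv_lhs => rw [← Finsupp.sum_single F, Finsupp.sum, map_sum]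
    refine Finset.sum_congr rfl fun x _ => ?_
    rw [← map_smul, Finsupp.smul_single, smul_eq_mul, mul_one]
  rw [moment, hF, LinearMap.map_sum₂, sq, Finset.sum_mul_sum, Finset.sum_mul]
  refine Finset.sum_le_sum fun x _ => ?_
  rw [map_sum, Finset.sum_mul]
  refine Finset.sum_le_sum fun y _ => ?_
  rw [map_smul, map_smul, LinearMap.smul_apply, smul_eq_mul, smul_eq_mul, ← mul_assoc,
    mul_comm (F y)]
  have hxy : |ip ((adjacency S ^ n) (Finsupp.single x 1))
      ((adjacency S ^ n) (Finsupp.single y 1))| ≤ c := by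
    refine abs_le_of_sq_le_sq ((ip_sq_le _ _).trans ?_) ((moment_nonneg _ _).trans (hc x))
    rw [sq]
    exact mul_le_mul (hc x) (hc y) (moment_nonneg _ _) ((moment_nonneg _ _).trans (hc x))
  refine (le_abs_self _).trans ?_
  rw [abs_mul, abs_mul]
  exact mul_le_mul_of_nonneg_left hxy (by positivity)

/-- A bound for the return numbers at all points bounds the operator norm. -/
theorem moment_le (hsymm : ∀ s ∈ S, s⁻¹ ∈ S) {Λ : ℝ} (hΛ : 0 < Λ)
    (h : ∀ (n : ℕ) (x : X), moment S (Finsupp.single x 1) n ≤ Λ ^ n) (F : X →₀ ℝ) (m : ℕ) :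
    moment S F m ≤ Λ ^ m * ip F F := by
  rcases (ip_self_nonneg F).eq_or_lt with h0 | h0
  · have h1 := moment_add_sq_le hsymm F 0 m
    rw [zero_add, mul_zero, moment_zero, ← h0, zero_mul] at h1
    rw [← h0, mul_zero]
    exact (pow_eq_zero_iff two_ne_zero).1 (le_antisymm h1 (sq_nonneg _)) |>.le
  · by_contra hlt
    rw [not_le, ← lt_div_iff₀ h0] at hlt
    -- `r > 1` is the supposed excess. Doubling `k` times raises it to the power `2 ^ k`, whereas
    -- the crude bound keeps that power below the fixed constant `C`.
    set r := moment S F m / ip F F / Λ ^ m with hr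
    have hr1 : 1 < r := by rwa [hr, one_lt_div (by positivity)]
    set C := (∑ x ∈ F.support, |F x|) ^ 2 / ip F F with hC
    obtain ⟨k, hk⟩ := pow_unbounded_of_one_lt C hr1
    have h2 : r ^ k ≤ r ^ 2 ^ k := pow_le_pow_right₀ hr1.le Nat.lt_two_pow_self.le
    have h3 : r ^ 2 ^ k ≤ C := by
      rw [hr, div_pow, div_le_iff₀ (by positivity)]
      refine (moment_pow_le hsymm h0 m k).trans ?_
      rw [hC, div_mul_eq_mul_div, ← pow_mul, mul_comm m]
      exact div_le_div_of_nonneg_right (moment_le_sum_abs F (h _)) h0.le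
    linarith

end Walk

end MarkedGroup

/-! ### Comparing functions on `G` with functions on `G ⧸ N`. -/

namespace MarkedGroup

section CosetNorm

variable {G : Type*} [Group G] (N : Subgroup G)

/-- The `ℓ²`-norms of the restrictions of `f` to the cosets of `N`. -/
noncomputable def cosetNorm (f : G →₀ ℝ) : (G ⧸ N) →₀ ℝ :=
  ((f.mapRange (· ^ 2) (by simp)).mapDomain (QuotientGroup.mk (s := N))).mapRange
    Real.sqrt Real.sqrt_zero

variable {N}

theorem cosetNorm_apply [DecidableEq (G ⧸ N)] {f : G →₀ ℝ} {T : Finset G} (hT : f.support ⊆ T)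
    (x : G ⧸ N) :
    cosetNorm N f x = √(∑ g ∈ T with QuotientGroup.mk (s := N) g = x, f g ^ 2) := by
  rw [cosetNorm, Finsupp.mapRange_apply, Finsupp.mapDomain, Finsupp.sum_apply,
    Finsupp.sum_of_support_subset (s := T) _
      ((Finsupp.support_mapRange (f := (· ^ 2)) (hf := by simp)).trans hT) _ (by simp),
    Finset.sum_filter]
  simp [Finsupp.single_apply]

theorem support_cosetNorm_subset [DecidableEq (G ⧸ N)] {f : G →₀ ℝ} {T : Finset G}
    (hT : f.support ⊆ T) : (cosetNorm N f).support ⊆ T.image (QuotientGroup.mk (s := N)) := by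
  refine Finsupp.support_mapRange.trans (Finsupp.mapDomain_support.trans ?_)
  exact Finset.image_mono _ (Finsupp.support_mapRange.trans hT)

theorem ip_cosetNorm_self (f : G →₀ ℝ) : ip (cosetNorm N f) (cosetNorm N f) = ip f f := by
  classical
  rw [ip_eq_sum _ (support_cosetNorm_subset subset_rfl), ip_eq_sum _ subset_rfl,
    ← Finset.sum_fiberwise_of_maps_to (s := f.support)
      (t := f.support.image (QuotientGroup.mk (s := N))) (g := QuotientGroup.mk)
      (fun g hg => Finset.mem_image_of_mem _ hg)]
  refine Finset.sum_congr rfl fun x _ => ?_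
  rw [cosetNorm_apply subset_rfl, Real.mul_self_sqrt (Finset.sum_nonneg fun _ _ => sq_nonneg _)]
  exact Finset.sum_congr rfl fun _ _ => sq _

/-- Cauchy–Schwarz on each coset separately. -/
theorem ip_le_ip_cosetNorm (f f' : G →₀ ℝ) : ip f f' ≤ ip (cosetNorm N f) (cosetNorm N f') := by
  classical
  set T := f.support ∪ f'.support
  have h1 : f.support ⊆ T := Finset.subset_union_left
  have h2 : f'.support ⊆ T := Finset.subset_union_right
  rw [ip_eq_sum _ (support_cosetNorm_subset h1), ip_eq_sum _ h1,
    ← Finset.sum_fiberwise_of_maps_to (s := T)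
      (t := T.image (QuotientGroup.mk (s := N))) (g := QuotientGroup.mk)
      (fun g hg => Finset.mem_image_of_mem _ hg)]
  refine Finset.sum_le_sum fun x _ => ?_
  rw [cosetNorm_apply h1, cosetNorm_apply h2]
  exact Real.sum_mul_le_sqrt_mul_sqrt _ _ _

theorem translate_cosetNorm (h : G) (f : G →₀ ℝ) :
    translate h (cosetNorm N f) = cosetNorm N (translate h f) := by
  ext x
  rw [translate_apply, cosetNorm, cosetNorm, Finsupp.mapRange_apply, Finsupp.mapRange_apply,
    ← translate_apply]
  have h1 : (translate h f).mapRange (· ^ 2) (by simp) =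
      translate h (f.mapRange (· ^ 2) (by simp)) := by
    ext g
    rw [Finsupp.mapRange_apply, translate_apply, translate_apply, Finsupp.mapRange_apply]
  rw [h1]
  congr 2
  exact Finsupp.mapDomain_comp.symm.trans
    (Finsupp.mapDomain_comp (f := (h • · : G → G)) (g := QuotientGroup.mk (s := N)))

/-- By normality every coset has stabilizer `N`. So `N` acts trivially on the quotient, and the walk
has the same return numbers at all its points. -/
theorem smul_quotient_eq_iff [hN : N.Normal] (h : G) (x : G ⧸ N) : h • x = x ↔ h ∈ N := by
  obtain ⟨g, rfl⟩ := QuotientGroup.mk_surjective x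
  change ((h * g : G) : G ⧸ N) = g ↔ _
  rw [eq_comm, QuotientGroup.eq]
  constructor
  · intro hg
    have := hN.conj_mem _ hg g
    rwa [mul_inv_cancel_left, mul_inv_cancel_right] at this
  · intro hh
    have := hN.conj_mem _ hh g⁻¹
    rwa [inv_inv, mul_assoc] at this

theorem translate_of_mem [N.Normal] {h : G} (hh : h ∈ N) (F : (G ⧸ N) →₀ ℝ) :
    translate h F = F := by
  ext x
  rw [translate_apply, (smul_quotient_eq_iff _ _).2 (inv_mem hh)]

variable {S : Finset G}

theorem moment_single {X : Type*} [MulAction G X] [DecidableEq X] (hsymm : ∀ s ∈ S, s⁻¹ ∈ S)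
    (x : X) (n : ℕ) :
    moment S (Finsupp.single x 1) n = ((words S (2 * n)).filter fun w => eval w • x = x).card := by
  rw [moment_eq hsymm, adjacency_pow_apply, LinearMap.map_sum₂]
  simp_rw [translate_single, ip_single_single, mul_one]
  rw [Finset.sum_boole]

/-- If `f` is nearly an eigenvector of the walk on `G` for the norm of the walk on `G ⧸ N`, then it
is nearly invariant under the elements of `N`. -/
theorem ip_sub_ip_translate_le [N.Normal] (hsymm : ∀ s ∈ S, s⁻¹ ∈ S) {Λ : ℝ} (hΛ : 0 < Λ)
    (h : ∀ (n : ℕ) (x : G ⧸ N), moment S (Finsupp.single x 1) n ≤ Λ ^ n) (f : G →₀ ℝ) {m : ℕ}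
    {w : List S} (hw : w.length = 2 * m) (hwN : eval w ∈ N) :
    ip f f - ip (translate (eval w) f) f ≤ Λ ^ m * ip f f - moment S f m := by
  have h1 := moment_le hsymm hΛ h (cosetNorm N f) m
  have h2 : ∀ v : List S, 0 ≤ ip (translate (eval v) (cosetNorm N f)) (cosetNorm N f) -
      ip (translate (eval v) f) f := fun v => by
    rw [sub_nonneg, translate_cosetNorm]
    exact ip_le_ip_cosetNorm _ _
  -- The gaps in `h2` are nonnegative and sum, over the words of length `2 * m`, to the difference
  -- of the moments of `cosetNorm N f` and `f`. The gap of `w` alone is therefore at most this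
  -- difference.
  have h3 := Finset.single_le_sum (fun v _ => h2 v) (mem_words.2 hw)
  rw [Finset.sum_sub_distrib, ← LinearMap.map_sum₂, ← LinearMap.map_sum₂, ← adjacency_pow_apply,
    ← adjacency_pow_apply, ← moment_eq hsymm, ← moment_eq hsymm, translate_of_mem hwN,
    ip_cosetNorm_self] at h3
  rw [ip_cosetNorm_self] at h1
  linarith

end CosetNorm

end MarkedGroup

/-! ### Ratio limits, and invariant means from almost invariant functions. -/

namespace MarkedGroup

open Filter Topology

/-- A log-convex sequence of which the growth rate bounds the ratios has ratios converging to its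
growth rate. -/
theorem tendsto_ratio {b : ℕ → ℝ} {Λ : ℝ} (h0 : b 0 = 1) (hpos : ∀ n, 0 < b n)
    (hconv : ∀ n, b (n + 1) ^ 2 ≤ b n * b (n + 2)) (hle : ∀ n, b (n + 1) ≤ Λ * b n)
    (hΛ : ∀ L, 0 < L → (∀ n, b n ≤ L ^ n) → Λ ≤ L) (m : ℕ) :
    Tendsto (fun n => b (n + m) / b n) atTop (𝓝 (Λ ^ m)) := by
  have hmono : Monotone fun n => b (n + 1) / b n := by
    refine monotone_nat_of_le_succ fun n => ?_
    rw [div_le_div_iff₀ (hpos _) (hpos _), ← sq, mul_comm]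
    exact hconv n
  have hle' : ∀ n, b (n + 1) / b n ≤ Λ := fun n => by
    rw [div_le_iff₀ (hpos _)]; exact hle n
  have hbdd : BddAbove (Set.range fun n => b (n + 1) / b n) := ⟨Λ, by
    rintro _ ⟨n, rfl⟩; exact hle' n⟩
  have hlim := tendsto_atTop_ciSup hmono hbdd
  set ℓ := ⨆ n, b (n + 1) / b n with hℓ
  have h1 : ∀ n, b (n + 1) / b n ≤ ℓ := fun n => le_ciSup hbdd n
  have hℓpos : 0 < ℓ := (div_pos (hpos 1) (hpos 0)).trans_le (h1 0)
  have h2 : ∀ n, b n ≤ ℓ ^ n := by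
    intro n
    induction n with
    | zero => simp [h0]
    | succ n ih =>
      rw [pow_succ']
      exact ((div_le_iff₀ (hpos _)).1 (h1 n)).trans (mul_le_mul_of_nonneg_left ih hℓpos.le)
  -- The increasing ratios have a limit `ℓ`, which by `h2` is itself an admissible growth rate;
  -- minimality of `Λ` applies.
  have h3 : ℓ = Λ := le_antisymm (ciSup_le hle') (hΛ ℓ hℓpos h2)
  rw [h3] at hlim
  induction m with
  | zero => simp [div_self (hpos _).ne']
  | succ m ih =>
    rw [pow_succ']
    refine ((hlim.comp (tendsto_add_atTop_nat m)).mul ih).congr fun n => ?_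
    have := (hpos (n + m)).ne'
    have := (hpos n).ne'
    simp only [Function.comp, add_assoc]
    field_simp

section Mass

variable {G : Type*}

/-- The mass that the density `f ^ 2` gives to a set. -/
noncomputable def mass (f : G →₀ ℝ) (B : Set G) : ℝ :=
  f.sum fun g a => B.indicator (fun _ => a ^ 2) g

theorem mass_eq_sum {f : G →₀ ℝ} {T : Finset G} (hT : f.support ⊆ T) (B : Set G) :
    mass f B = ∑ g ∈ T, B.indicator (fun _ => f g ^ 2) g :=
  Finsupp.sum_of_support_subset f hT _ (by simp)

theorem mass_nonneg (f : G →₀ ℝ) (B : Set G) : 0 ≤ mass f B :=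
  Finset.sum_nonneg fun _ _ => Set.indicator_nonneg (fun _ _ => sq_nonneg _) _

theorem mass_univ (f : G →₀ ℝ) : mass f Set.univ = ip f f := by
  rw [mass_eq_sum subset_rfl, ip_eq_sum _ subset_rfl]
  simp [sq]

theorem mass_le (f : G →₀ ℝ) (B : Set G) : mass f B ≤ ip f f := by
  rw [← mass_univ]
  exact Finset.sum_le_sum fun g _ =>
    Set.indicator_le_indicator_of_subset (Set.subset_univ B) (fun _ => sq_nonneg _) g

theorem mass_union (f : G →₀ ℝ) {B C : Set G} (h : Disjoint B C) :
    mass f (B ∪ C) = mass f B + mass f C := by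
  rw [mass, mass, mass, ← Finsupp.sum_add]
  simp only [Set.indicator_union_of_disjoint h]

/-- Factor `F² - f² = (F - f)(F + f)` and apply Cauchy–Schwarz; the bound is uniform in `B`. -/
theorem sq_mass_sub_mass_le (F f : G →₀ ℝ) (B : Set G) :
    (mass F B - mass f B) ^ 2 ≤ ip (F - f) (F - f) * ip (F + f) (F + f) := by
  classical
  set T := F.support ∪ f.support
  have h1 : F.support ⊆ T := Finset.subset_union_left
  have h2 : f.support ⊆ T := Finset.subset_union_right
  have h3 : mass F B - mass f B =
      ∑ g ∈ T, B.indicator (fun _ => (F - f) g) g * (F + f) g := by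
    rw [mass_eq_sum h1, mass_eq_sum h2, ← Finset.sum_sub_distrib]
    refine Finset.sum_congr rfl fun g _ => ?_
    by_cases hg : g ∈ B
    · simp only [Set.indicator_of_mem hg, Finsupp.sub_apply, Finsupp.add_apply]; ring
    · simp [Set.indicator_of_notMem hg]
  rw [h3, ip_eq_sum _ (Finsupp.support_sub.trans (Finset.union_subset h1 h2)),
    ip_eq_sum _ (Finsupp.support_add.trans (Finset.union_subset h1 h2))]
  refine (Finset.sum_mul_sq_le_sq_mul_sq _ _ _).trans ?_
  simp only [← sq]
  refine mul_le_mul_of_nonneg_right (Finset.sum_le_sum fun g _ => ?_)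
    (Finset.sum_nonneg fun _ _ => sq_nonneg _)
  by_cases hg : g ∈ B
  · rw [Set.indicator_of_mem hg]
  · rw [Set.indicator_of_notMem hg, sq, mul_zero]; exact sq_nonneg _

variable [Group G]

theorem mass_translate (h : G) (f : G →₀ ℝ) (B : Set G) :
    mass (translate h f) B = mass f ((h * ·) ⁻¹' B) :=
  Finsupp.sum_mapDomain_index_inj (mul_right_injective h)

theorem sq_mass_translate_sub_le (h : G) (f : G →₀ ℝ) (B : Set G) :
    (mass (translate h f) B - mass f B) ^ 2 ≤
      8 * ip f f * (ip f f - ip (translate h f) f) := by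
  refine (sq_mass_sub_mass_le _ _ B).trans ?_
  have h1 := ip_translate_translate h f f
  have h2 := ip_self_nonneg (translate h f - f)
  simp only [map_sub, map_add, LinearMap.sub_apply, LinearMap.add_apply, h1,
    ip_comm f (translate h f)] at h2 ⊢
  -- With `a = ip f f` and `b = ip (translate h f) f`, the product is `2(a - b) * 2(a + b)`, and `b
  -- ≤ a` by `h2`.
  nlinarith

/-- The ultralimit of a sequence of probability measures given by densities `f n ^ 2`. -/
theorem exists_mean (f : ℕ → G →₀ ℝ) (hf : ∀ n, 0 < ip (f n) (f n)) :
    ∃ M : Set G → ℝ, (∀ B, 0 ≤ M B) ∧ M Set.univ = 1 ∧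
      (∀ B C, Disjoint B C → M (B ∪ C) = M B + M C) ∧
      ∀ h : G, Tendsto (fun n => ip (translate h (f n)) (f n) / ip (f n) (f n)) atTop (𝓝 1) →
        ∀ B, M ((h * ·) ⁻¹' B) = M B := by
  -- A nonprincipal ultrafilter gives limits for all sets at once, the normalized masses lying in
  -- the compact interval `[0, 1]`.
  let U : Ultrafilter ℕ := hyperfilter ℕ
  have hU : (U : Filter ℕ) ≤ atTop := by
    rw [← Nat.cofinite_eq_atTop]; exact hyperfilter_le_cofinite
  have hlim : ∀ B : Set G, ∃ x : ℝ, x ∈ Set.Icc (0 : ℝ) 1 ∧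
      Tendsto (fun n => mass (f n) B / ip (f n) (f n)) U (𝓝 x) := by
    intro B
    refine isCompact_Icc.ultrafilter_le_nhds
      (U.map fun n => mass (f n) B / ip (f n) (f n)) ?_
    rw [le_principal_iff]
    refine (Eventually.of_forall fun n => ?_ :
      ∀ᶠ n in (U : Filter ℕ), mass (f n) B / ip (f n) (f n) ∈ Set.Icc (0 : ℝ) 1)
    exact ⟨div_nonneg (mass_nonneg _ _) (hf n).le, (div_le_one (hf n)).2 (mass_le _ _)⟩
  choose M hM01 hM using hlim
  refine ⟨M, fun B => (hM01 B).1, ?_, fun B C hBC => ?_, fun h hh B => ?_⟩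
  · refine tendsto_nhds_unique (hM Set.univ) (tendsto_const_nhds.congr fun n => ?_)
    rw [mass_univ, div_self (hf n).ne']
  · refine tendsto_nhds_unique (hM _) (((hM B).add (hM C)).congr fun n => ?_)
    rw [mass_union _ hBC, add_div]
  · have h1 : Tendsto (fun n => (mass (f n) ((h * ·) ⁻¹' B) / ip (f n) (f n) -
        mass (f n) B / ip (f n) (f n)) ^ 2) U (𝓝 ((M ((h * ·) ⁻¹' B) - M B) ^ 2)) :=
      ((hM _).sub (hM B)).pow 2
    have h2 : Tendsto (fun n => 8 * (1 - ip (translate h (f n)) (f n) / ip (f n) (f n))) U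
        (𝓝 (8 * (1 - 1))) := ((hh.mono_left hU).const_sub 1).const_mul 8
    have h3 := le_of_tendsto_of_tendsto' h1 h2 fun n => by
      rw [← sub_div, div_pow, div_le_iff₀ (pow_pos (hf n) 2), ← mass_translate]
      refine (sq_mass_translate_sub_le h (f n) B).trans_eq ?_
      have := (hf n).ne'
      field_simp
    have h4 : (M ((h * ·) ⁻¹' B) - M B) ^ 2 = 0 := le_antisymm (by simpa using h3) (sq_nonneg _)
    exact sub_eq_zero.1 ((pow_eq_zero_iff two_ne_zero).1 h4)

/-- A subgroup is amenable as soon as the group has a mean invariant under the subgroup. -/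
theorem isAmenable_of_mean (N : Subgroup G) (M : Set G → ℝ) (h0 : ∀ B, 0 ≤ M B)
    (h1 : M Set.univ = 1) (h2 : ∀ B C, Disjoint B C → M (B ∪ C) = M B + M C)
    (h3 : ∀ h ∈ N, ∀ B, M ((h * ·) ⁻¹' B) = M B) : IsAmenable N := by
  -- Dividing `g` on the right by a chosen representative of its coset `N g` gives an
  -- `N`-equivariant map to `N`, along which the mean is pushed forward.
  obtain ⟨τ, hτ⟩ : ∃ τ : G → N, ∀ (h : N) (g : G), τ (h * g) = h * τ g := by
    let r : Setoid G := QuotientGroup.rightRel N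
    have hr : ∀ g : G, g * (Quotient.out (Quotient.mk r g))⁻¹ ∈ N := fun g =>
      QuotientGroup.rightRel_apply.1 (Quotient.mk_out g)
    refine ⟨fun g => ⟨_, hr g⟩, fun h g => Subtype.ext ?_⟩
    have : Quotient.mk r (h * g) = Quotient.mk r g := Quotient.sound <| by
      refine QuotientGroup.rightRel_apply.2 ?_
      rw [mul_inv_rev, mul_inv_cancel_left]
      exact inv_mem h.2
    simp only [this, Subgroup.coe_mul, mul_assoc]
  refine ⟨fun A => M (τ ⁻¹' A), fun A => h0 _, h1, fun A B hAB => ?_, fun h A => ?_⟩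
  · exact h2 _ _ (hAB.preimage τ)
  · dsimp only
    rw [← h3 _ (inv_mem h.2) (τ ⁻¹' A)]
    congr 1
    ext g
    have : τ ((h : G)⁻¹ * g) = h⁻¹ * τ g := hτ h⁻¹ g
    simp only [Set.mem_preimage, this, Set.mem_image]
    constructor
    · rintro ⟨x, hx, hxg⟩
      rwa [← hxg, inv_mul_cancel_left]
    · intro hx
      exact ⟨_, hx, mul_inv_cancel_left _ _⟩

end Mass

end MarkedGroup

/-! ### Kesten's criterion and the spectral radius. -/

namespace MarkedGroup

open Filter Topology

section Kesten

variable {G : Type*} [Group G] {S : Finset G}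

open Classical in
/-- The number of words of length `n` representing an element of `N`. -/
noncomputable def wordCount (S : Finset G) (N : Subgroup G) (n : ℕ) : ℕ :=
  ((words S n).filter fun w => eval w ∈ N).card

theorem wordCount_even_eq_moment (hsymm : ∀ s ∈ S, s⁻¹ ∈ S) (N : Subgroup G) [N.Normal]
    (x : G ⧸ N) (n : ℕ) :
    moment S (Finsupp.single x 1) n = wordCount S N (2 * n) := by
  classical
  rw [moment_single hsymm, wordCount]
  simp only [smul_quotient_eq_iff]

theorem wordCount_bot_eq_moment (hsymm : ∀ s ∈ S, s⁻¹ ∈ S) (x : G) (n : ℕ) :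
    moment S (Finsupp.single x 1) n = wordCount S ⊥ (2 * n) := by
  classical
  rw [moment_single hsymm, wordCount]
  simp only [smul_eq_mul, mul_eq_right, Subgroup.mem_bot]

theorem wordCount_mono (S : Finset G) {N N' : Subgroup G} (h : N ≤ N') (n : ℕ) :
    wordCount S N n ≤ wordCount S N' n := by
  classical
  exact Finset.card_le_card (Finset.monotone_filter_right _ fun _ _ hw => h hw)

theorem wordCount_le (S : Finset G) (N : Subgroup G) (n : ℕ) : wordCount S N n ≤ S.card ^ n := by
  classical
  rw [← card_words]
  exact Finset.card_filter_le _ _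

theorem wordCount_zero (S : Finset G) (N : Subgroup G) : wordCount S N 0 = 1 := by
  classical
  rw [wordCount, words, Finset.filter_true_of_mem, Finset.card_singleton]
  intro w hw
  rw [Finset.mem_singleton.1 hw]
  exact one_mem N

theorem wordCount_bot_pos (hsymm : ∀ s ∈ S, s⁻¹ ∈ S) (hS : S.Nonempty) (n : ℕ) :
    0 < wordCount S ⊥ (2 * n) := by
  classical
  obtain ⟨s, hs⟩ := hS
  obtain ⟨v, hv, hvw⟩ := exists_eval_eq_inv hsymm (List.replicate n (⟨s, hs⟩ : S))
  refine Finset.card_pos.2 ⟨v ++ List.replicate n ⟨s, hs⟩, Finset.mem_filter.2 ⟨?_, ?_⟩⟩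
  · rw [mem_words, List.length_append, hv, List.length_replicate, two_mul]
  · rw [Subgroup.mem_bot, eval_append, hvw, inv_mul_cancel]

/-- **Kesten's criterion**: if the walk on `G ⧸ N` does not return more often, on the exponential
scale, than the walk on `G`, then `N` is amenable. -/
theorem isAmenable_of_wordCount_le (hsymm : ∀ s ∈ S, s⁻¹ ∈ S)
    (hgen : Subgroup.closure (S : Set G) = ⊤) (hS : S.Nonempty) (N : Subgroup G) [N.Normal] {Λ : ℝ}
    (hN : ∀ n, (wordCount S N (2 * n) : ℝ) ≤ Λ ^ n)
    (hΛ : ∀ L, 0 < L → (∀ n, (wordCount S ⊥ (2 * n) : ℝ) ≤ L ^ n) → Λ ≤ L) : IsAmenable N := by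
  have hbot : ∀ n, (wordCount S ⊥ (2 * n) : ℝ) ≤ Λ ^ n := fun n =>
    (Nat.cast_le.2 (wordCount_mono S bot_le _)).trans (hN n)
  have hΛ0 : 0 < Λ := by
    have h1 : (0 : ℝ) < wordCount S ⊥ (2 * 1) := Nat.cast_pos.2 (wordCount_bot_pos hsymm hS 1)
    simpa using h1.trans_le (hbot 1)
  set δ : G →₀ ℝ := Finsupp.single 1 1 with hδ
  have hmom : ∀ n, moment S δ n = wordCount S ⊥ (2 * n) := wordCount_bot_eq_moment hsymm 1
  have hpos : ∀ n, 0 < moment S δ n := fun n => by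
    rw [hmom]; exact Nat.cast_pos.2 (wordCount_bot_pos hsymm hS n)
  have hratio : ∀ m, Tendsto (fun n => moment S δ (n + m) / moment S δ n) atTop (𝓝 (Λ ^ m)) := by
    refine tendsto_ratio ?_ hpos (moment_succ_sq_le hsymm δ) (fun n => ?_) fun L hL h => ?_
    · rw [hmom, mul_zero, wordCount_zero, Nat.cast_one]
    · have := moment_le (X := G) hsymm hΛ0
        (fun k x => (wordCount_bot_eq_moment hsymm x k).trans_le (hbot k))
        ((adjacency S ^ n) δ) 1
      rwa [moment_adjacency_pow, pow_one] at this
    · exact hΛ L hL fun n => (hmom n).symm.trans_le (h n)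
  have hself : ∀ n, ip ((adjacency S ^ n) δ) ((adjacency S ^ n) δ) = moment S δ n := fun _ => rfl
  obtain ⟨M, h0, h1, h2, h3⟩ := exists_mean (fun n => (adjacency S ^ n) δ) hpos
  -- The normalized correlation of `f_n` with its translate is squeezed between a lower bound from
  -- `ip_sub_ip_translate_le`, which tends to 1 by the ratio limit, and 1. Moments see only even
  -- powers, hence the parity condition.
  have heven : ∀ w : List S, Even w.length → eval w ∈ N →
      ∀ B, M ((eval w * ·) ⁻¹' B) = M B := by
    intro w hw hwN
    obtain ⟨m, hm⟩ := hw.two_dvd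
    refine h3 _ ?_
    have hlow : Tendsto (fun n => 1 - (Λ ^ m - moment S δ (n + m) / moment S δ n)) atTop (𝓝 1) := by
      have := ((hratio m).const_sub (Λ ^ m)).const_sub 1
      rwa [sub_self, sub_zero] at this
    refine tendsto_of_tendsto_of_tendsto_of_le_of_le hlow tendsto_const_nhds (fun n => ?_)
      fun n => ?_
    · have := ip_sub_ip_translate_le (N := N) hsymm hΛ0
        (fun k x => (wordCount_even_eq_moment hsymm N x k).trans_le (hN k))
        ((adjacency S ^ n) δ) hm hwN
      rw [moment_adjacency_pow, hself] at this
      dsimp only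
      rw [hself, le_div_iff₀ (hpos n), sub_mul, sub_mul, div_mul_cancel₀ _ (hpos n).ne']
      linarith
    · dsimp only
      rw [hself, div_le_one (hpos n)]
      refine le_of_sq_le_sq ((ip_sq_le _ _).trans_eq ?_) (hpos n).le
      rw [ip_translate_translate, hself, sq]
  by_cases hodd : ∃ t : List S, Odd t.length ∧ eval t ∈ N
  · obtain ⟨t, ht, htN⟩ := hodd
    obtain ⟨t', ht', htt'⟩ := exists_eval_eq_inv hsymm t
    have hcomp : ∀ (a b : G) (B : Set G),
        (a * ·) ⁻¹' ((b * ·) ⁻¹' B) = (b * a * ·) ⁻¹' B := fun a b B => by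
      ext g; simp [mul_assoc]
    -- Average `M` with its translate by the odd element `eval t` of `N`: even words in `N` fix both
    -- means and odd ones exchange them.
    refine isAmenable_of_mean N (fun B => (M B + M ((eval t * ·) ⁻¹' B)) / 2) (fun B => ?_) ?_
      (fun B C hBC => ?_) fun h hh B => ?_
    · exact div_nonneg (add_nonneg (h0 _) (h0 _)) zero_le_two
    · rw [Set.preimage_univ, h1]; norm_num
    · rw [Set.preimage_union, h2 _ _ hBC, h2 _ _ (hBC.preimage _)]; ring
    · obtain ⟨w, rfl⟩ := exists_eval_eq hsymm hgen h
      rw [hcomp]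
      rcases Nat.even_or_odd w.length with hw | hw
      · have hlen : Even (t' ++ (w ++ t)).length := by
          simp only [List.length_append, ht']
          exact ht.add_odd (hw.add_odd ht)
        have hev : eval (t' ++ (w ++ t)) = (eval t)⁻¹ * (eval w * eval t) := by
          rw [eval_append, eval_append, htt']
        have := heven _ hlen (by
          rw [hev]; exact mul_mem (inv_mem htN) (mul_mem hh htN)) ((eval t * ·) ⁻¹' B)
        rw [hcomp, hev, mul_inv_cancel_left] at this
        rw [heven w hw hh, this]
      · have hlen : Even (t' ++ w).length := by
          simp only [List.length_append, ht']
          exact ht.add_odd hw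
        have hev : eval (t' ++ w) = (eval t)⁻¹ * eval w := by
          rw [eval_append, htt']
        have h4 := heven _ hlen (by
          rw [hev]; exact mul_mem (inv_mem htN) hh) ((eval t * ·) ⁻¹' B)
        rw [hcomp, hev, mul_inv_cancel_left] at h4
        have h5 := heven (w ++ t) (by
          simp only [List.length_append]
          exact hw.add_odd ht) (by rw [eval_append]; exact mul_mem hh htN) B
        rw [eval_append] at h5
        rw [h4, h5, add_comm]
  · refine isAmenable_of_mean N M h0 h1 h2 fun h hh B => ?_
    obtain ⟨w, rfl⟩ := exists_eval_eq hsymm hgen h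
    exact heven w (Nat.not_odd_iff_even.1 fun hw => hodd ⟨w, hw, hh⟩) hh B

end Kesten

section SpectralRadius

variable {G : Type*} [Group G] {S : Finset G}

theorem returnProb_eq (S : Finset G) (n : ℕ) :
    returnProb S n = wordCount S ⊥ n / (S.card : ℝ) ^ n := by
  classical
  rw [returnProb, wordCount]
  congr 2
  exact Nat.subtype_card _ fun w => by rw [Finset.mem_filter, mem_words, Subgroup.mem_bot]

theorem returnProb_nonneg (S : Finset G) (n : ℕ) : 0 ≤ returnProb S n := by
  unfold returnProb; positivity

theorem returnProb_le_one (S : Finset G) (n : ℕ) : returnProb S n ≤ 1 := by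
  rw [returnProb_eq]
  refine div_le_one_of_le₀ ?_ (by positivity)
  exact_mod_cast wordCount_le S ⊥ n

theorem returnProb_rpow_le_one (S : Finset G) (n : ℕ) : returnProb S n ^ (1 / (n : ℝ)) ≤ 1 :=
  Real.rpow_le_one (returnProb_nonneg S n) (returnProb_le_one S n) (by positivity)

theorem isCoboundedUnder_returnProb (S : Finset G) :
    IsCoboundedUnder (· ≤ ·) atTop fun n : ℕ => returnProb S n ^ (1 / (n : ℝ)) :=
  isCoboundedUnder_le_of_le atTop (x := 0) fun n => Real.rpow_nonneg (returnProb_nonneg S n) _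

theorem isBoundedUnder_returnProb (S : Finset G) :
    IsBoundedUnder (· ≤ ·) atTop fun n : ℕ => returnProb S n ^ (1 / (n : ℝ)) :=
  isBoundedUnder_of ⟨1, returnProb_rpow_le_one S⟩

theorem spectralRadius_nonneg (S : Finset G) : 0 ≤ spectralRadius S :=
  le_limsup_of_frequently_le (Eventually.frequently (Eventually.of_forall fun n =>
    Real.rpow_nonneg (returnProb_nonneg S n) _)) (isBoundedUnder_returnProb S)

/-- The limsup also runs over odd lengths; Cauchy–Schwarz bounds an odd return count by the
geometric mean of the two neighbouring even ones. -/
theorem sq_spectralRadius_le (hsymm : ∀ s ∈ S, s⁻¹ ∈ S) (hS : S.Nonempty) {L : ℝ} (hL : 0 < L)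
    (h : ∀ n, (wordCount S ⊥ (2 * n) : ℝ) ≤ L ^ n) : (spectralRadius S * S.card) ^ 2 ≤ L := by
  classical
  have hS0 : (0 : ℝ) < S.card := Nat.cast_pos.2 hS.card_pos
  have h1 : ∀ n, (wordCount S ⊥ n : ℝ) ≤ √L ^ n := by
    intro n
    refine le_of_sq_le_sq ?_ (by positivity)
    rw [← pow_mul, mul_comm n, pow_mul, Real.sq_sqrt hL.le]
    have hm : ∀ n, moment S (Finsupp.single (1 : G) 1) n ≤ L ^ n := fun n =>
      (wordCount_bot_eq_moment hsymm 1 n).trans_le (h n)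
    have hn : ip ((adjacency S ^ n) (Finsupp.single (1 : G) 1)) (Finsupp.single 1 1) =
        wordCount S ⊥ n := by
      rw [adjacency_pow_apply, LinearMap.map_sum₂]
      simp_rw [translate_single, ip_single_single, mul_one]
      rw [Finset.sum_boole, wordCount]
      simp only [smul_eq_mul, mul_one, Subgroup.mem_bot]
    rw [← hn]
    rcases Nat.even_or_odd' n with ⟨k, rfl | rfl⟩
    · have := ip_pow_add_sq_le hsymm (Finsupp.single (1 : G) 1) k k
      rw [← two_mul] at this
      refine this.trans ((mul_le_mul (hm k) (hm k) (moment_nonneg _ _) (by positivity)).trans_eq ?_)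
      ring
    · have := ip_pow_add_sq_le hsymm (Finsupp.single (1 : G) 1) k (k + 1)
      rw [← add_assoc, ← two_mul] at this
      refine this.trans ((mul_le_mul (hm k) (hm (k + 1)) (moment_nonneg _ _)
        (by positivity)).trans_eq ?_)
      ring
  have h2 : spectralRadius S ≤ √L / S.card := by
    refine limsup_le_of_le (isCoboundedUnder_returnProb S) ?_
    filter_upwards [eventually_ne_atTop 0] with n hn
    have h3 : returnProb S n ≤ (√L / S.card) ^ n := by
      rw [returnProb_eq, div_pow]
      exact div_le_div_of_nonneg_right (h1 n) (by positivity)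
    calc returnProb S n ^ (1 / (n : ℝ)) ≤ ((√L / S.card) ^ n) ^ (1 / (n : ℝ)) :=
          Real.rpow_le_rpow (returnProb_nonneg S n) h3 (by positivity)
      _ = √L / S.card := by
          rw [one_div, Real.pow_rpow_inv_natCast (by positivity) hn]
  rw [le_div_iff₀ hS0] at h2
  calc (spectralRadius S * S.card) ^ 2 ≤ √L ^ 2 :=
        pow_le_pow_left₀ (mul_nonneg (spectralRadius_nonneg S) hS0.le) h2 2
    _ = L := Real.sq_sqrt hL.le

/-- Doubling shows that the root `p(2n)^(1/2n)` is attained or exceeded at all lengths `2^i * 2n`,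
hence is at most the limsup. Because the bound holds at every length, not only asymptotically, one
finite list of words can refute triviality. -/
theorem wordCount_le_spectralRadius_pow (hsymm : ∀ s ∈ S, s⁻¹ ∈ S) (hS : S.Nonempty) (n : ℕ) :
    (wordCount S ⊥ (2 * n) : ℝ) ≤ (spectralRadius S * S.card) ^ (2 * n) := by
  classical
  have hS0 : (0 : ℝ) < S.card := Nat.cast_pos.2 hS.card_pos
  rcases Nat.eq_zero_or_pos n with rfl | hn
  · simp [wordCount_zero]
  have hδ : ip (Finsupp.single (1 : G) (1 : ℝ)) (Finsupp.single 1 1) = 1 := by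
    simp [ip_single_single]
  have h1 : ∀ i, returnProb S (2 * n) ^ 2 ^ i ≤ returnProb S (2 ^ i * (2 * n)) := by
    intro i
    have := moment_pow_le hsymm (F := Finsupp.single (1 : G) (1 : ℝ)) (hδ.symm ▸ one_pos) n i
    rw [hδ, div_one, div_one, wordCount_bot_eq_moment hsymm, wordCount_bot_eq_moment hsymm] at this
    rw [returnProb_eq, returnProb_eq, div_pow, ← pow_mul, mul_comm (2 * n),
      show 2 ^ i * (2 * n) = 2 * (2 ^ i * n) by ring]
    exact div_le_div_of_nonneg_right this (by positivity)
  have h2 : returnProb S (2 * n) ^ (1 / ((2 * n : ℕ) : ℝ)) ≤ spectralRadius S := by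
    refine le_limsup_of_frequently_le (frequently_atTop.2 fun k => ?_)
      (isBoundedUnder_returnProb S)
    refine ⟨2 ^ k * (2 * n), ?_, ?_⟩
    · exact Nat.lt_two_pow_self.le.trans (Nat.le_mul_of_pos_right _ (by omega))
    · refine le_trans ?_ (Real.rpow_le_rpow (pow_nonneg (returnProb_nonneg S _) _) (h1 k)
        (by positivity))
      rw [← Real.rpow_natCast, ← Real.rpow_mul (returnProb_nonneg S _)]
      refine le_of_eq ?_
      congr 1
      have : ((2 * n : ℕ) : ℝ) ≠ 0 := Nat.cast_ne_zero.2 (by omega)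
      rw [Nat.cast_mul (2 ^ k)]
      field_simp
  have h3 := pow_le_pow_left₀ (Real.rpow_nonneg (returnProb_nonneg S _) _) h2 (2 * n)
  rw [one_div, Real.rpow_inv_natCast_pow (returnProb_nonneg S _) (by omega), returnProb_eq,
    div_le_iff₀ (by positivity)] at h3
  rwa [mul_pow]

/-- Contrapositive of Kesten's criterion with `Λ = (ρ|S|)^2`. Length zero cannot be the witness,
both sides being 1 there. -/
theorem exists_lt_wordCount (hsymm : ∀ s ∈ S, s⁻¹ ∈ S)
    (hgen : Subgroup.closure (S : Set G) = ⊤) (hS : S.Nonempty) (N : Subgroup G) [N.Normal]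
    (hN : ¬ IsAmenable N) :
    ∃ n, n ≠ 0 ∧ (spectralRadius S * S.card) ^ (2 * n) < (wordCount S N (2 * n) : ℝ) := by
  by_contra! h
  refine hN (isAmenable_of_wordCount_le hsymm hgen hS N (Λ := (spectralRadius S * S.card) ^ 2)
    (fun n => ?_) fun L hL hn => sq_spectralRadius_le hsymm hS hL hn)
  rw [← pow_mul]
  rcases eq_or_ne n 0 with rfl | hn
  · simp [wordCount_zero]
  · exact h n hn

end SpectralRadius

end MarkedGroup

/-! ### Certificates of nontriviality. -/

theorem Primrec.nat_pow : Primrec₂ fun a n : ℕ => a ^ n :=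
  Primrec₂.unpaired'.1 Nat.Primrec.pow

theorem Primrec.primrecPred_nodup {α : Type*} [Primcodable α] :
    PrimrecPred fun l : List α => l.Nodup := by
  classical
  have hmem : PrimrecRel fun (l : List α) (a : α) => ∀ c ∈ l, c ≠ a :=
    PrimrecRel.forall_mem_list (R := fun c a : α => c ≠ a) Primrec.eq.not
  have hrec : Primrec fun l : List α =>
      (List.recOn l true fun a l ih => decide (∀ c ∈ l, c ≠ a) && ih : Bool) :=
    Primrec.list_rec (f := fun l : List α => l) Primrec.id (Primrec.const true)
      (h := fun _ p => decide (∀ c ∈ p.2.1, c ≠ p.1) && p.2.2)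
      (Primrec.and.comp ((primrecRel_iff_primrec_decide.1 hmem).comp
        (Primrec.fst.comp (Primrec.snd.comp Primrec.snd)) (Primrec.fst.comp Primrec.snd))
        (Primrec.snd.comp (Primrec.snd.comp Primrec.snd))).to₂
  refine primrecPred_iff_primrec_decide.2 (hrec.of_eq fun l => ?_)
  induction l with
  | nil => simp
  | cons a l ih =>
    simp only [ih, List.nodup_cons, Bool.decide_and]
    congr 1
    rw [decide_eq_decide]
    exact ⟨fun h ha => h a ha rfl, fun h c hc hca => h (hca ▸ hc)⟩

namespace MarkedGroup

variable {G : Type*} [Group G] {S : Finset G}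

/-- The list `y.2.2.2` of words, together with the number `y.1 / (y.2.1 + 1)`, witnesses that the
walk on the quotient by the normal closure of `eval w` has spectral radius greater than `ρ`. -/
def IsNontrivialityCert (ρ : ℝ) (w : List S) (y : ℕ × ℕ × ℕ × List (List S)) : Prop :=
  ρ < (RatCode.toRat ((y.1 : ℤ), y.2.1) : ℝ) ∧
    (∀ v ∈ y.2.2.2, eval v ∈ Subgroup.normalClosure {eval w} ∧ v.length = 2 * (y.2.2.1 + 1)) ∧
    y.2.2.2.Nodup ∧
    (S.card * y.1) ^ (2 * (y.2.2.1 + 1)) <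
      y.2.2.2.length * (y.2.1 + 1) ^ (2 * (y.2.2.1 + 1))

/-- Upper semi-computability handles the comparison with `ρ`, and the recursive presentation handles
membership of the listed words; the remaining conditions are decidable. -/
theorem rePred_isNontrivialityCert (hgen : Subgroup.closure (S : Set G) = ⊤)
    (hpres : IsRecursivelyPresented S) {ρ : ℝ} (hρ : IsUpperSemicomputable ρ) :
    REPred fun w : List S => ∃ y, IsNontrivialityCert ρ w y := by
  have ha : Primrec fun x : List S × (ℕ × ℕ × ℕ × List (List S)) => x.2.1 :=
    Primrec.fst.comp Primrec.snd
  have hb : Primrec fun x : List S × (ℕ × ℕ × ℕ × List (List S)) => x.2.2.1 :=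
    Primrec.fst.comp (Primrec.snd.comp Primrec.snd)
  have hm : Primrec fun x : List S × (ℕ × ℕ × ℕ × List (List S)) => x.2.2.2.1 :=
    Primrec.fst.comp (Primrec.snd.comp (Primrec.snd.comp Primrec.snd))
  have hL : Primrec fun x : List S × (ℕ × ℕ × ℕ × List (List S)) => x.2.2.2.2 :=
    Primrec.snd.comp (Primrec.snd.comp (Primrec.snd.comp Primrec.snd))
  have hn : Primrec fun x : List S × (ℕ × ℕ × ℕ × List (List S)) => 2 * (x.2.2.2.1 + 1) :=
    Primrec.nat_mul.comp (Primrec.const 2) (Primrec.succ.comp hm)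
  have h1 : REPred fun x : List S × (ℕ × ℕ × ℕ × List (List S)) =>
      ρ < (RatCode.toRat ((x.2.1 : ℤ), x.2.2.1) : ℝ) :=
    REPred.comp hρ.rePred_lt ((Primrec.int_ofNat.comp ha).pair hb).to_comp
  have h2 : REPred fun x : List S × (ℕ × ℕ × ℕ × List (List S)) =>
      ∀ v ∈ x.2.2.2.2, eval v ∈ Subgroup.normalClosure {eval x.1} ∧
        v.length = 2 * (x.2.2.2.1 + 1) := by
    have h := REPred.forall_mem_list (p := fun z : (List S × ℕ) × List S =>
        eval z.2 ∈ Subgroup.normalClosure {eval z.1.1} ∧ z.2.length = z.1.2)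
      (REPred.and
        (REPred.comp (hpres.rePred_eval_mem_normalClosure hgen)
          (f := fun z : (List S × ℕ) × List S => (z.1.1, z.2))
          ((Primrec.fst.comp Primrec.fst).pair Primrec.snd).to_comp)
        (PrimrecPred.computablePred (Primrec.eq.comp (Primrec.list_length.comp Primrec.snd)
          (Primrec.snd.comp Primrec.fst))).to_re)
    exact REPred.comp h (f := fun x : List S × (ℕ × ℕ × ℕ × List (List S)) =>
      ((x.1, 2 * (x.2.2.2.1 + 1)), x.2.2.2.2)) ((Primrec.fst.pair hn).pair hL).to_comp
  have h3 : REPred fun x : List S × (ℕ × ℕ × ℕ × List (List S)) => x.2.2.2.2.Nodup :=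
    (PrimrecPred.computablePred (Primrec.primrecPred_nodup.comp hL)).to_re
  have h4 : REPred fun x : List S × (ℕ × ℕ × ℕ × List (List S)) =>
      (S.card * x.2.1) ^ (2 * (x.2.2.2.1 + 1)) <
        x.2.2.2.2.length * (x.2.2.1 + 1) ^ (2 * (x.2.2.2.1 + 1)) :=
    (PrimrecPred.computablePred (Primrec.nat_lt.comp
      (Primrec.nat_pow.comp (Primrec.nat_mul.comp (Primrec.const S.card) ha) hn)
      (Primrec.nat_mul.comp (Primrec.list_length.comp hL)
        (Primrec.nat_pow.comp (Primrec.succ.comp hb) hn)))).to_re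
  exact (h1.and (h2.and (h3.and h4))).exists_snd

theorem IsNontrivialityCert.eval_ne_one (hsymm : ∀ s ∈ S, s⁻¹ ∈ S) {w : List S}
    {y : ℕ × ℕ × ℕ × List (List S)} (h : IsNontrivialityCert (spectralRadius S) w y) :
    eval w ≠ 1 := by
  classical
  obtain ⟨a, b, m, L⟩ := y
  obtain ⟨h1, h2, h3, h4⟩ := h
  simp only at h1 h2 h3 h4
  intro hw
  have hbot : Subgroup.normalClosure {eval w} = ⊥ := by
    rw [hw]; exact le_bot_iff.1 (Subgroup.normalClosure_le_normal (by simp))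
  rw [hbot] at h2
  set n := 2 * (m + 1) with hn
  -- The strict inequality forces a listed word, and its length `2 * (m + 1)` is positive, so it
  -- contains a letter.
  have hS : S.Nonempty := by
    rcases L with _ | ⟨v, L⟩
    · simp at h4
    · have hv := (h2 v List.mem_cons_self).2
      rcases v with _ | ⟨s, v⟩
      · simp [hn] at hv
      · exact ⟨s, s.2⟩
  have hS0 : (0 : ℝ) < S.card := Nat.cast_pos.2 hS.card_pos
  have hb0 : (0 : ℝ) < (b : ℝ) + 1 := by positivity
  have h5 : L.length ≤ wordCount S ⊥ n := by
    rw [← List.toFinset_card_of_nodup h3]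
    refine Finset.card_le_card fun v hv => ?_
    rw [Finset.mem_filter, mem_words]
    exact (h2 v (List.mem_toFinset.1 hv)).symm
  have h6 := (Nat.cast_le (α := ℝ).2 h5).trans (wordCount_le_spectralRadius_pow hsymm hS (m + 1))
  have h7 : ((S.card : ℝ) * a) ^ n < L.length * ((b : ℝ) + 1) ^ n := by exact_mod_cast h4
  have h8 : spectralRadius S * (b + 1) ≤ a := by
    rw [RatCode.toRat] at h1
    push_cast at h1
    rw [lt_div_iff₀ hb0] at h1
    exact h1.le
  have h9 : (L.length : ℝ) * ((b : ℝ) + 1) ^ n ≤ ((S.card : ℝ) * a) ^ n :=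
    calc (L.length : ℝ) * ((b : ℝ) + 1) ^ n
        ≤ (spectralRadius S * S.card) ^ n * ((b : ℝ) + 1) ^ n :=
          mul_le_mul_of_nonneg_right h6 (by positivity)
      _ = (S.card * (spectralRadius S * (b + 1))) ^ n := by rw [← mul_pow]; ring
      _ ≤ (S.card * a) ^ n := by
        have := spectralRadius_nonneg S
        gcongr
  linarith

theorem exists_isNontrivialityCert (hsymm : ∀ s ∈ S, s⁻¹ ∈ S)
    (hgen : Subgroup.closure (S : Set G) = ⊤) {w : List S} (hw : eval w ≠ 1)
    (hN : ¬ IsAmenable (Subgroup.normalClosure {eval w})) :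
    ∃ y, IsNontrivialityCert (spectralRadius S) w y := by
  classical
  have hS : S.Nonempty := by
    rcases w with _ | ⟨s, w⟩
    · exact absurd rfl hw
    · exact ⟨s, s.2⟩
  have hS0 : (0 : ℝ) < S.card := Nat.cast_pos.2 hS.card_pos
  obtain ⟨n, hn, hlt⟩ := exists_lt_wordCount hsymm hgen hS _ hN
  obtain ⟨m, rfl⟩ := Nat.exists_eq_succ_of_ne_zero hn
  set k := 2 * (m + 1) with hk
  have hρ := spectralRadius_nonneg S
  -- The strict inequality from Kesten's criterion survives replacing `ρ` by a slightly larger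
  -- rational number.
  have hcont : Filter.Tendsto (fun q : ℝ => (q * S.card) ^ k)
      (nhdsWithin (spectralRadius S) (Set.Ioi (spectralRadius S)))
      (nhds ((spectralRadius S * S.card) ^ k)) :=
    Filter.Tendsto.mono_left (Continuous.tendsto (by fun_prop) _) nhdsWithin_le_nhds
  obtain ⟨z, hz, hzlt⟩ := ((hcont.eventually_lt_const hlt).and self_mem_nhdsWithin).exists
  obtain ⟨q, hq1, hq2⟩ := exists_rat_btwn hzlt
  have hq0 : (0 : ℝ) < q := hρ.trans_lt hq1
  have hqlt : ((q : ℝ) * S.card) ^ k < wordCount S (Subgroup.normalClosure {eval w}) k := by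
    refine lt_of_le_of_lt ?_ hz
    gcongr
  obtain ⟨a, ha⟩ := Int.eq_ofNat_of_zero_le (Rat.num_pos.2 (by exact_mod_cast hq0)).le
  obtain ⟨b, hb⟩ := Nat.exists_eq_succ_of_ne_zero q.den_nz
  have hqab : q = (a : ℚ) / ((b : ℚ) + 1) := by
    conv_lhs => rw [← Rat.num_div_den q, ha, hb]
    push_cast; rfl
  refine ⟨(a, b, m, ((words S k).filter fun v => eval v ∈ Subgroup.normalClosure {eval w}).toList),
    ?_, fun v hv => ?_, Finset.nodup_toList _, ?_⟩
  · have : RatCode.toRat ((a : ℤ), b) = q := by rw [hqab, RatCode.toRat]; simp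
    rw [this]; exact hq1
  · rw [Finset.mem_toList, Finset.mem_filter, mem_words] at hv
    exact hv.symm
  · have hb0 : (0 : ℝ) < (b : ℝ) + 1 := by positivity
    have h1 : (q : ℝ) * S.card = S.card * a / (b + 1) := by
      rw [hqab]; push_cast; ring
    rw [h1, div_pow, div_lt_iff₀ (by positivity)] at hqlt
    simp only [Finset.length_toList]
    exact_mod_cast hqlt

end MarkedGroup

/-! ### The decision procedure. -/

theorem mainTheorem3 {G : Type*} [Group G] (S : Finset G)
    (hsymm : ∀ s ∈ S, s⁻¹ ∈ S) (hgen : Subgroup.closure (S : Set G) = ⊤)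
    (hpres : MarkedGroup.IsRecursivelyPresented S)
    (hrho : MarkedGroup.IsUpperSemicomputable (MarkedGroup.spectralRadius S)) :
    (∀ W : Set (List S),
      (∀ w ∈ W, MarkedGroup.eval w = 1 ∨
        ¬ MarkedGroup.IsAmenable (Subgroup.normalClosure {MarkedGroup.eval w})) →
      MarkedGroup.WordProblemDecidableOn W) ∧
    ((∀ w : List S, MarkedGroup.eval w = 1 ∨
        ¬ MarkedGroup.IsAmenable (Subgroup.normalClosure {MarkedGroup.eval w})) →
      MarkedGroup.HasDecidableWordProblem S) := by
  have htriv := hpres.rePred_eval_eq_one hgen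
  have hnontriv := MarkedGroup.rePred_isNontrivialityCert hgen hpres hrho
  have hsound : ∀ w : List S,
      (∃ y, MarkedGroup.IsNontrivialityCert (MarkedGroup.spectralRadius S) w y) →
        MarkedGroup.eval w ≠ 1 := fun w ⟨y, hy⟩ => hy.eval_ne_one hsymm
  have hcomplete : ∀ w : List S, (MarkedGroup.eval w = 1 ∨
      ¬ MarkedGroup.IsAmenable (Subgroup.normalClosure {MarkedGroup.eval w})) →
      MarkedGroup.eval w ≠ 1 →
        ∃ y, MarkedGroup.IsNontrivialityCert (MarkedGroup.spectralRadius S) w y :=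
    fun w hw hne => MarkedGroup.exists_isNontrivialityCert hsymm hgen hne (hw.resolve_left hne)
  constructor
  · intro W hW
    -- Both searches run in parallel. Soundness of certificates holds for all words, so the answers
    -- never conflict, even outside `W`.
    obtain ⟨f, hf, hfspec⟩ := Partrec.merge (htriv.map (Computable.const true).to₂)
      (hnontriv.map (Computable.const false).to₂) (by
        intro w x hx y hy
        simp only [Part.mem_map_iff, Part.mem_assert_iff, Part.mem_some_iff, exists_prop,
          and_true, exists_const] at hx hy
        exact absurd hx.1 (hsound w hy.1))
    refine ⟨f, hf, fun w hw => ?_⟩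
    by_cases h1 : MarkedGroup.eval w = 1
    · refine ⟨true, (hfspec w true).2 (Or.inl ?_), by simp [h1]⟩
      simpa using h1
    · refine ⟨false, (hfspec w false).2 (Or.inr ?_), by simp [h1]⟩
      simpa using hcomplete w (hW w hw) h1
  · intro hW
    -- Post's theorem: certificates now enumerate the whole complement.
    exact ComputablePred.computable_iff_re_compl_re'.2 ⟨htriv, hnontriv.of_eq fun w =>
      ⟨hsound w, hcomplete w (hW w)⟩⟩
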